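/- Let $n \ge 1$. A convex body in $\mathbb{R}^n$ is a non-empty compact convex subset (it may have empty interior); write $h_K(u)=\max_{x\in K}\langle x,u\rangle$ for its support function. Let $$V(K_1,\dots,K_n)=\frac{1}{n!}\sum_{I\subseteq\{1,\dots,n\}}(-1)^{n-|I|}\operatorname{vol}\Bigl(\sum_{i\in I}K_i\Bigr)$$ be the mixed volume (sums are Minkowski sums, and the empty sum is $\{0\}$). For a convex body $K$, let $S(K)$ be its surface area measure on $\mathbb{S}^{n-1}$, that is, the weak limit, as $\rho\to 0^+$, of the measures $$\omega\mapsto \rho^{-1}\operatorname{vol}\Bigl\{x\in\mathbb{R}^n : 0<d(x,K)\le\rho,\ \tfrac{x-p_K(x)}{d(x,K)}\in\omega\Bigr\},$$ where $p_K(x)$ is the point of $K$ nearest to $x$. Let $$S(P_1,\dots,P_{n-1})=\frac{1}{(n-1)!}\sum_{I\subseteq\{1,\dots,n-1\}}(-1)^{n-1-|I|}\,S\Bigl(\sum_{i\in I}P_i\Bigr)$$ be the mixed area measure, a finite non-negative Borel measure on $\mathbb{S}^{n-1}$. Then for all convex bodies $P_1,\dots,P_{n-1},Q,Q'$ in $\mathbb{R}^n$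 with $Q\subseteq Q'$, $$V(P_1,\dots,P_{n-1},Q')-V(P_1,\dots,P_{n-1},Q)=\frac1n\int_{\mathbb{S}^{n-1}}(h_{Q'}-h_Q)\,\mathrm{d}S(P_1,\dots,P_{n-1}).$$ -/

import Mathlib

open MeasureTheory Filter Topology

noncomputable section

namespace ConvexBody

/-- The unit sphere of `ℝ^n`. -/
abbrev UnitSphere (n : ℕ) : Type :=
  Metric.sphere (0 : EuclideanSpace ℝ (Fin n)) 1

/-- The support function `h_K(u) = max_{x ∈ K} ⟨x, u⟩`. -/
def supportFunction {n : ℕ} (K : ConvexBody (EuclideanSpace ℝ (Fin n)))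
    (u : EuclideanSpace ℝ (Fin n)) : ℝ :=
  sSup ((fun x => inner ℝ x u) '' (K : Set (EuclideanSpace ℝ (Fin n))))

/-- The mixed volume of `n` convex bodies in `ℝ^n`, i.e. the symmetric Minkowski-multilinear form
whose diagonal is the volume, given by polarization:
`V(K₁, …, Kₙ) = (1 / n!) ∑_{I ⊆ {1, …, n}} (-1)^(n - |I|) vol (∑_{i ∈ I} K_i)`. -/
def mixedVolume {n : ℕ} (K : Fin n → ConvexBody (EuclideanSpace ℝ (Fin n))) : ℝ :=
  (n.factorial : ℝ)⁻¹ * ∑ I : Finset (Fin n), (-1 : ℝ) ^ (n - I.card) *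
    volume.real ((∑ i ∈ I, K i : ConvexBody (EuclideanSpace ℝ (Fin n))) :
      Set (EuclideanSpace ℝ (Fin n)))

/-- The metric projection `p(K, x)`: the point of `K` nearest to `x`. -/
def nearestPoint {n : ℕ} (K : ConvexBody (EuclideanSpace ℝ (Fin n)))
    (x : EuclideanSpace ℝ (Fin n)) : EuclideanSpace ℝ (Fin n) :=
  (K.isCompact.exists_infDist_eq_dist K.nonempty x).choose

/-- The vector `u(K, x) = (x - p(K, x)) / d(K, x)`, a unit vector for `x ∉ K`. -/
def outerNormal {n : ℕ} (K : ConvexBody (EuclideanSpace ℝ (Fin n)))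
    (x : EuclideanSpace ℝ (Fin n)) : EuclideanSpace ℝ (Fin n) :=
  (Metric.infDist x (K : Set (EuclideanSpace ℝ (Fin n))))⁻¹ • (x - K.nearestPoint x)

/-- The parallel shell `{x | 0 < d(K, x) ≤ ρ}`. -/
def shell {n : ℕ} (K : ConvexBody (EuclideanSpace ℝ (Fin n))) (ρ : ℝ) :
    Set (EuclideanSpace ℝ (Fin n)) :=
  {x | 0 < Metric.infDist x (K : Set (EuclideanSpace ℝ (Fin n))) ∧
    Metric.infDist x (K : Set (EuclideanSpace ℝ (Fin n))) ≤ ρ}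

theorem volume_shell_lt_top {n : ℕ} (K : ConvexBody (EuclideanSpace ℝ (Fin n))) (ρ : ℝ) :
    volume (K.shell ρ) < ⊤ := by
  have hb : Bornology.IsBounded
      (Metric.cthickening ρ (K : Set (EuclideanSpace ℝ (Fin n)))) := K.isBounded.cthickening
  refine lt_of_le_of_lt (measure_mono ?_) hb.measure_lt_top
  intro x hx
  obtain ⟨y, hy, hxy⟩ := K.isCompact.exists_infDist_eq_dist K.nonempty x
  exact Metric.mem_cthickening_of_dist_le x y ρ _ hy (hxy ▸ hx.2)

/-- The local parallel volume of `K`, as a measure on the unit sphere: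
`ω ↦ vol {x | 0 < d(K, x) ≤ ρ, u(K, x) ∈ ω}`. -/
def localParallelVolume {n : ℕ} (K : ConvexBody (EuclideanSpace ℝ (Fin n))) (ρ : ℝ) :
    FiniteMeasure (UnitSphere n) :=
  ⟨((volume.restrict (K.shell ρ)).map K.outerNormal).comap Subtype.val, by
    have : IsFiniteMeasure (volume.restrict (K.shell ρ)) :=
      ⟨by simpa using K.volume_shell_lt_top ρ⟩
    refine ⟨?_⟩
    rw [comap_subtype_coe_apply Metric.isClosed_sphere.measurableSet]
    exact measure_lt_top _ _⟩

/-- The surface area measure `S(K) = S_{n-1}(K, ·)` of a convex body in `ℝ^n`, the coefficient of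
`ρ` in the local Steiner formula, i.e. the weak limit of `ρ⁻¹ vol {0 < d(K, x) ≤ ρ, u(K, x) ∈ ·}`
as `ρ → 0+`. -/
def surfaceAreaMeasure {n : ℕ} (K : ConvexBody (EuclideanSpace ℝ (Fin n))) :
    FiniteMeasure (UnitSphere n) :=
  limUnder (𝓝[>] (0 : ℝ)) fun ρ => (ρ⁻¹).toNNReal • K.localParallelVolume ρ

/-- The polarization of the surface area measure in dimension `n = m + 1`, as a signed measure:
`(1 / m!) ∑_{I ⊆ {1, …, m}} (-1)^(m - |I|) S(∑_{i ∈ I} P_i)`. -/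
def mixedAreaSignedMeasure {m : ℕ} (P : Fin m → ConvexBody (EuclideanSpace ℝ (Fin (m + 1)))) :
    SignedMeasure (UnitSphere (m + 1)) :=
  (m.factorial : ℝ)⁻¹ • ∑ I : Finset (Fin m), (-1 : ℝ) ^ (m - I.card) •
    (surfaceAreaMeasure (∑ i ∈ I, P i) : Measure (UnitSphere (m + 1))).toSignedMeasure

/-- The mixed area measure `S(P₁, …, P_{n-1})` of `n - 1 = m` convex bodies in `ℝ^n`. It is the
polarization above, which is a nonnegative signed measure; the positive part of its Jordan
decomposition is taken only to have it as an object of type `Measure`. -/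
def mixedAreaMeasure {m : ℕ} (P : Fin m → ConvexBody (EuclideanSpace ℝ (Fin (m + 1)))) :
    Measure (UnitSphere (m + 1)) :=
  (mixedAreaSignedMeasure P).toJordanDecomposition.posPart

end ConvexBody

end

/-!
The mixed volume `V(P₁, …, P_{n-1}, L)` equals `(1 / n) ∫ h_L dS(P₁, …, P_{n-1})` for every convex
body `L`; the theorem is the difference of two instances of this identity.

*Volume.* Mollifying the support function of `K` gives a smooth convex function `g`, a potential of
`K`, whose gradient map takes values in `K`, covers the interior of `K`, and is injective where its
derivative is invertible. Hence `vol K = ∫ det (Hess g)` over all of `ℝ^n`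
(`ConvexBody.IsPotential.integral_det_hessianMatrix`). Potentials add under Minkowski addition, so
`n! V(K₁, …, Kₙ)` is the integral of the polarized determinant `Matrix.mixedDet` of the Hessians
(`ConvexBody.factorial_mul_mixedVolume`). Multilinearity of the mixed volume follows at once, and
nonnegativity of mixed discriminants of positive semidefinite matrices gives both monotonicity
(`ConvexBody.mixedVolumeLast_mono`) and a second order expansion of `t ↦ vol (K + t L)` whose
linear coefficient is `n V(K, …, K, L)` (`ConvexBody.volume_add_smul_bounds`).

*Surface area.* Moving points outwards along the normals of `K` does not decrease distances, so the
local parallel volumes are superadditive in the radius; therefore the limit defining the surface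
area measure `S(K)` exists, even in total variation (`exists_tendsto_of_superadditive`). Since
`K + ρ L` is contained in the region swept out by moving boundary points by `ρ h_L(u)` along their
normals `u`, one gets `n V(K, …, K, L) ≤ ∫ h_L dS(K)` when `h_L ≥ 0`, with equality for the unit
ball. Both sides are additive in `L`, so equality holds for all such summands `L` of a ball
(`ConvexBody.mul_mixedVolumeLast_eq_integral_of_add`).

*Density.* Functions on the sphere with uniform quadratic expansions form a point-separating
algebra, dense by the Stone–Weierstrass theorem, and after adding a large constant each of them is
the support function of a summand of a ball
(`ConvexBody.exists_supportFunction_eq_and_integral_eq`).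
Polarizing the identity for `S(K)` shows that the functional `f ↦ ∫ f dS(P₁, …, P_{n-1})`, taken
against the signed polarization, is nonnegative by monotonicity of mixed volumes, and that it sends
`h_L` to `n V(P₁, …, P_{n-1}, L)` by approximation. Nonnegativity identifies the polarization with
the positive part in its Jordan decomposition.
-/

/-! ### Mixed discriminants -/

section Polarization

variable {ι E : Type*} [Fintype ι] [DecidableEq ι] [AddCommGroup E] [Module ℝ E]

theorem Finset.sum_neg_one_pow_card_compl_of_subset (s : Finset ι) :
    ∑ I : Finset ι, (if s ⊆ I then (-1 : ℝ) ^ (Fintype.card ι - I.card) else 0) =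
      if s = Finset.univ then 1 else 0 := by
  have h1 : ∑ I : Finset ι, (if s ⊆ I then (-1 : ℝ) ^ (Fintype.card ι - I.card) else 0) =
      ∑ J : Finset ι, (if J ⊆ sᶜ then (-1 : ℝ) ^ J.card else 0) := by
    refine Fintype.sum_equiv (Equiv.mk compl compl compl_compl compl_compl) _ _ fun I => ?_
    simp [Finset.card_compl]
  rw [h1, ← Finset.sum_filter]
  have h2 : Finset.univ.filter (fun J : Finset ι => J ⊆ sᶜ) = sᶜ.powerset := by
    ext J; simp
  have h3 := Finset.sum_powerset_neg_one_pow_card (x := sᶜ)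
  rw [h2]
  have h4 : ∑ J ∈ sᶜ.powerset, (-1 : ℝ) ^ J.card =
      ((∑ J ∈ sᶜ.powerset, (-1 : ℤ) ^ J.card : ℤ) : ℝ) := by push_cast; rfl
  rw [h4, h3]
  simp [Finset.compl_eq_empty_iff]

/-- Polarization: the alternating sum of the diagonal values of a multilinear form at the partial
sums of a family is the symmetrization of the form, evaluated at that family. -/
theorem MultilinearMap.sum_neg_one_pow_card_diagonal
    (M : MultilinearMap ℝ (fun _ : ι => E) ℝ) (v : ι → E) :
    ∑ I : Finset ι, (-1 : ℝ) ^ (Fintype.card ι - I.card) * M (fun _ => ∑ i ∈ I, v i) =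
      ∑ σ : Equiv.Perm ι, M fun i => v (σ i) := by
  have h1 : ∀ I : Finset ι, M (fun _ => ∑ i ∈ I, v i) =
      ∑ r : ι → ι, if Finset.univ.image r ⊆ I then M (fun i => v (r i)) else 0 := by
    intro I
    rw [MultilinearMap.map_sum_finset, ← Finset.sum_filter]
    refine Finset.sum_congr ?_ fun _ _ => rfl
    ext r
    simp [Fintype.mem_piFinset, Finset.image_subset_iff]
  simp_rw [h1, Finset.mul_sum]
  rw [Finset.sum_comm]
  have h2 : ∀ r : ι → ι, ∑ I : Finset ι, (-1 : ℝ) ^ (Fintype.card ι - I.card) *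
      (if Finset.univ.image r ⊆ I then M (fun i => v (r i)) else 0) =
      if Function.Bijective r then M (fun i => v (r i)) else 0 := by
    intro r
    have : ∀ I : Finset ι, (-1 : ℝ) ^ (Fintype.card ι - I.card) *
      (if Finset.univ.image r ⊆ I then M (fun i => v (r i)) else 0) =
      (if Finset.univ.image r ⊆ I then (-1 : ℝ) ^ (Fintype.card ι - I.card) else 0) *
        M (fun i => v (r i)) := by
      intro I; split_ifs <;> simp
    simp_rw [this]
    rw [← Finset.sum_mul, Finset.sum_neg_one_pow_card_compl_of_subset]
    have hb : Finset.univ.image r = Finset.univ ↔ Function.Bijective r := by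
      rw [← Finite.surjective_iff_bijective, Finset.eq_univ_iff_forall]
      simp [Function.Surjective]
    simp only [hb]
    split_ifs <;> simp
  simp_rw [h2]
  rw [← Finset.sum_filter]
  symm
  refine Finset.sum_bij (fun σ _ => (σ : ι → ι)) ?_ ?_ ?_ ?_
  · intro σ _; simp
  · intro σ _ τ _ h; exact Equiv.coe_fn_injective h
  · intro r hr
    exact ⟨Equiv.ofBijective r (by simpa using hr), Finset.mem_univ _, rfl⟩
  · intro σ _; rfl

end Polarization

section MixedDet

open scoped MatrixOrder

variable {ι : Type*} [Fintype ι] [DecidableEq ι]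

/-- The determinant of the matrix whose `i`-th row is the `i`-th row of `A i`, as a multilinear
form in the family of matrices `A`. -/
noncomputable def Matrix.rowDet : MultilinearMap ℝ (fun _ : ι => Matrix ι ι ℝ) ℝ :=
  (Matrix.detRowAlternating (R := ℝ) (n := ι)).toMultilinearMap.compLinearMap
    fun i => (LinearMap.proj i : (ι → ι → ℝ) →ₗ[ℝ] (ι → ℝ))

theorem Matrix.rowDet_apply (A : ι → Matrix ι ι ℝ) :
    Matrix.rowDet A = Matrix.det (Matrix.of fun i j => A i i j) := rfl

/-- The mixed discriminant of a family of matrices, normalized so that its diagonal is `n!` times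
the determinant. -/
noncomputable def Matrix.mixedDet : MultilinearMap ℝ (fun _ : ι => Matrix ι ι ℝ) ℝ :=
  ∑ σ : Equiv.Perm ι, Matrix.rowDet.domDomCongr σ

theorem Matrix.mixedDet_apply (A : ι → Matrix ι ι ℝ) :
    Matrix.mixedDet A = ∑ σ : Equiv.Perm ι, Matrix.rowDet fun i => A (σ i) := by
  simp [Matrix.mixedDet]

theorem Matrix.mixedDet_perm (A : ι → Matrix ι ι ℝ) (τ : Equiv.Perm ι) :
    Matrix.mixedDet (fun i => A (τ i)) = Matrix.mixedDet A := by
  rw [Matrix.mixedDet_apply, Matrix.mixedDet_apply]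
  exact Fintype.sum_equiv (Equiv.mulLeft τ) _ _ fun σ => rfl

theorem Matrix.mixedDet_diag (A : Matrix ι ι ℝ) :
    Matrix.mixedDet (fun _ : ι => A) = ((Fintype.card ι).factorial : ℝ) * A.det := by
  rw [Matrix.mixedDet_apply]
  simp [Matrix.rowDet_apply, Fintype.card_perm]
  left; rfl

theorem Matrix.sum_neg_one_pow_card_det (A : ι → Matrix ι ι ℝ) :
    ∑ I : Finset ι, (-1 : ℝ) ^ (Fintype.card ι - I.card) * (∑ i ∈ I, A i).det =
      Matrix.mixedDet A := by
  rw [Matrix.mixedDet_apply, ← MultilinearMap.sum_neg_one_pow_card_diagonal]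
  rfl

/-- The mixed discriminant of positive semidefinite matrices `Bᵢᵀ Bᵢ` is nonnegative: by
multilinearity it is the sum over `s` of the squares of `det (row s i of B i)`. -/
theorem Matrix.mixedDet_nonneg (A : ι → Matrix ι ι ℝ) (hA : ∀ i, (A i).PosSemidef) :
    0 ≤ Matrix.mixedDet A := by
  have hB : ∀ i, ∃ B : Matrix ι ι ℝ, A i = B.conjTranspose * B := by
    intro i
    exact (CStarAlgebra.nonneg_iff_eq_star_mul_self.mp (hA i).nonneg)
  choose B hB using hB
  have key : Matrix.mixedDet A =
      ∑ s : ι → ι, (Matrix.det (Matrix.of fun i j => B i (s i) j)) ^ 2 := by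
    rw [Matrix.mixedDet_apply]
    have h1 : ∀ σ : Equiv.Perm ι, Matrix.rowDet (fun i => A (σ i)) =
        ∑ s : ι → ι, (∏ k, B (σ k) (s (σ k)) k) *
          (((Equiv.Perm.sign σ : ℤ) : ℝ) * Matrix.det (Matrix.of fun i j => B i (s i) j)) := by
      intro σ
      have e1 : Matrix.rowDet (fun i => A (σ i)) =
          (Matrix.detRowAlternating (R := ℝ) (n := ι)).toMultilinearMap
            (fun k => ∑ r : ι, B (σ k) r k • B (σ k) r) := by
        rw [Matrix.rowDet_apply]
        change Matrix.det _ = Matrix.det _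
        congr 1
        ext k l
        simp [hB, Matrix.mul_apply, Finset.sum_apply]
      rw [e1, MultilinearMap.map_sum]
      refine (Fintype.sum_equiv (Equiv.arrowCongr σ (Equiv.refl ι)) _ _ fun r => ?_)
      rw [MultilinearMap.map_smul_univ]
      simp only [Equiv.arrowCongr_apply, Function.comp, Equiv.coe_refl, id,
        Equiv.symm_apply_apply, smul_eq_mul]
      congr 1
      rw [← Matrix.det_permute]
      change Matrix.det _ = Matrix.det _
      congr 1
      ext k l
      simp
    simp_rw [h1]
    rw [Finset.sum_comm]
    refine Finset.sum_congr rfl fun s _ => ?_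
    have h2 : ∀ σ : Equiv.Perm ι, (∏ k, B (σ k) (s (σ k)) k) *
          (((Equiv.Perm.sign σ : ℤ) : ℝ) * Matrix.det (Matrix.of fun i j => B i (s i) j)) =
        (((Equiv.Perm.sign σ : ℤ) : ℝ) * ∏ k, (Matrix.of fun i j => B i (s i) j) (σ k) k) *
          Matrix.det (Matrix.of fun i j => B i (s i) j) := by
      intro σ; simp only [Matrix.of_apply]; ring
    simp_rw [h2]
    rw [← Finset.sum_mul, ← Matrix.det_apply', sq]
  rw [key]
  exact Finset.sum_nonneg fun s _ => sq_nonneg _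

end MixedDet

section Expansion

variable {m : ℕ}

/-- The mixed discriminant with a distinguished last argument `B`, as a multilinear form in the
others. -/
noncomputable def Matrix.mixedDetLast (B : Matrix (Fin (m + 1)) (Fin (m + 1)) ℝ) :
    MultilinearMap ℝ (fun _ : Fin m => Matrix (Fin (m + 1)) (Fin (m + 1)) ℝ) ℝ where
  toFun A := Matrix.mixedDet
    (Fin.snoc (α := fun _ => Matrix (Fin (m + 1)) (Fin (m + 1)) ℝ) A B)
  map_update_add' {inst} A i x y := by
    cases Subsingleton.elim (instDecidableEqFin m) inst
    simp [Fin.snoc_update]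
  map_update_smul' {inst} A i c x := by
    cases Subsingleton.elim (instDecidableEqFin m) inst
    simp [Fin.snoc_update]

theorem Matrix.sum_neg_one_pow_card_mixedDet_snoc
    (A : Fin m → Matrix (Fin (m + 1)) (Fin (m + 1)) ℝ)
    (B : Matrix (Fin (m + 1)) (Fin (m + 1)) ℝ) :
    ∑ I : Finset (Fin m), (-1 : ℝ) ^ (m - I.card) *
      Matrix.mixedDet (Fin.snoc (α := fun _ => Matrix (Fin (m + 1)) (Fin (m + 1)) ℝ)
        (fun _ => ∑ i ∈ I, A i) B) =
      (m.factorial : ℝ) *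
        Matrix.mixedDet (Fin.snoc (α := fun _ => Matrix (Fin (m + 1)) (Fin (m + 1)) ℝ) A B) := by
  have h := MultilinearMap.sum_neg_one_pow_card_diagonal (Matrix.mixedDetLast B) A
  rw [Fintype.card_fin] at h
  refine h.trans ?_
  have h2 : ∀ σ : Equiv.Perm (Fin m), Matrix.mixedDetLast B (fun i => A (σ i)) =
      Matrix.mixedDet (Fin.snoc (α := fun _ => Matrix (Fin (m + 1)) (Fin (m + 1)) ℝ) A B) := by
    intro σ
    let τ : Equiv.Perm (Fin (m + 1)) :=
      (finSuccEquivLast.trans (Equiv.optionCongr σ)).trans finSuccEquivLast.symm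
    rw [← Matrix.mixedDet_perm _ τ]
    change Matrix.mixedDet _ = _
    congr 1
    funext i
    refine Fin.lastCases ?_ (fun j => ?_) i
    · simp [τ]
    · simp [τ]
  simp_rw [h2]
  simp [Fintype.card_perm]

/-- Second order control of `t ↦ det (A + t B)` at `0` for positive semidefinite `A` and `B`: all
the coefficients of this polynomial are nonnegative, so the terms of degree at least two lie
between `0` and `t² det (A + B)`. -/
theorem Matrix.det_add_smul_bounds (A B : Matrix (Fin (m + 1)) (Fin (m + 1)) ℝ)
    (hA : A.PosSemidef) (hB : B.PosSemidef) (t : ℝ) (ht0 : 0 ≤ t) (ht1 : t ≤ 1) :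
    A.det + t * ((m.factorial : ℝ)⁻¹ * Matrix.mixedDet
        (Fin.snoc (α := fun _ => Matrix (Fin (m + 1)) (Fin (m + 1)) ℝ) (fun _ => A) B)) ≤
      (A + t • B).det ∧
    (A + t • B).det ≤ A.det + t * ((m.factorial : ℝ)⁻¹ * Matrix.mixedDet
        (Fin.snoc (α := fun _ => Matrix (Fin (m + 1)) (Fin (m + 1)) ℝ) (fun _ => A) B)) +
      t ^ 2 * (A + B).det := by
  classical
  set N : ℝ := ((m + 1).factorial : ℝ) with hN
  have hNpos : 0 < N := by positivity
  let c : Finset (Fin (m + 1)) → ℝ := fun s =>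
    Matrix.mixedDet (s.piecewise (fun _ => B) (fun _ => A))
  have hc : ∀ s, 0 ≤ c s := by
    intro s
    refine Matrix.mixedDet_nonneg _ fun i => ?_
    by_cases hi : i ∈ s <;> simp [Finset.piecewise, hi, hA, hB]
  have expand : ∀ t : ℝ, N * (A + t • B).det = ∑ s : Finset (Fin (m + 1)), t ^ s.card * c s := by
    intro t
    have h := Matrix.mixedDet_diag (A + t • B)
    rw [Fintype.card_fin] at h
    rw [hN, ← h]
    have h2 : (fun _ : Fin (m + 1) => A + t • B) =
        (fun _ => t • B) + (fun _ => A) := by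
      funext i; simp [add_comm]
    rw [h2, MultilinearMap.map_add_univ]
    refine Finset.sum_congr rfl fun s _ => ?_
    have h3 := Matrix.mixedDet.map_piecewise_smul (fun _ => t)
      (s.piecewise (fun _ : Fin (m + 1) => B) (fun _ => A)) s
    simp only [Finset.prod_const, smul_eq_mul] at h3
    rw [← h3]
    congr 1
    funext i
    by_cases hi : i ∈ s <;> simp [Finset.piecewise, hi]
  have csing : ∀ i : Fin (m + 1), c {i} = Matrix.mixedDet
      (Fin.snoc (α := fun _ => Matrix (Fin (m + 1)) (Fin (m + 1)) ℝ) (fun _ => A) B) := by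
    intro i
    rw [← Matrix.mixedDet_perm _ (Equiv.swap i (Fin.last m))]
    simp only [c]
    congr 1
    funext j
    by_cases hj : j = i
    · subst hj; simp [Finset.piecewise]
    · have : Equiv.swap i (Fin.last m) j ≠ Fin.last m := by
        intro h
        apply hj
        rw [Equiv.swap_apply_eq_iff, Equiv.swap_apply_right] at h
        exact h
      obtain ⟨k, hk⟩ := Fin.exists_castSucc_eq.mpr this
      rw [← hk, Fin.snoc_castSucc]
      simp [Finset.piecewise, hj]
  set D := Matrix.mixedDet
      (Fin.snoc (α := fun _ => Matrix (Fin (m + 1)) (Fin (m + 1)) ℝ) (fun _ => A) B) with hD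
  -- the terms of the expansion, split by the cardinality of the subset
  have split : ∀ t : ℝ, ∑ s : Finset (Fin (m + 1)), t ^ s.card * c s =
      N * A.det + t * ((m + 1 : ℕ) * D) +
        ∑ s : Finset (Fin (m + 1)), if 2 ≤ s.card then t ^ s.card * c s else 0 := by
    intro t
    have h0 : N * A.det =
        ∑ s : Finset (Fin (m + 1)), if s.card = 0 then t ^ s.card * c s else 0 := by
      have := expand 0
      simp only [zero_smul, add_zero] at this
      rw [this]
      refine Finset.sum_congr rfl fun s _ => ?_
      split_ifs with h <;> simp [h]
    have h1 : t * ((m + 1 : ℕ) * D) =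
        ∑ s : Finset (Fin (m + 1)), if s.card = 1 then t ^ s.card * c s else 0 := by
      rw [← Finset.sum_filter]
      have : Finset.univ.filter (fun s : Finset (Fin (m + 1)) => s.card = 1) =
          Finset.univ.map ⟨fun i => {i}, Finset.singleton_injective⟩ := by
        ext s
        simp only [Finset.mem_filter, Finset.mem_univ, true_and, Finset.mem_map,
          Function.Embedding.coeFn_mk, Finset.card_eq_one]
        exact ⟨fun ⟨a, h⟩ => ⟨a, h.symm⟩, fun ⟨a, h⟩ => ⟨a, h.symm⟩⟩
      rw [this, Finset.sum_map]
      simp only [Function.Embedding.coeFn_mk, Finset.card_singleton, pow_one, csing]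
      simp; ring
    rw [h0, h1, ← Finset.sum_add_distrib, ← Finset.sum_add_distrib]
    refine Finset.sum_congr rfl fun s _ => ?_
    rcases Nat.lt_or_ge s.card 2 with h | h
    · have : s.card = 0 ∨ s.card = 1 := by omega
      rcases this with h | h <;> simp [h]
    · have a0 : s.card ≠ 0 := by omega
      have a1 : s.card ≠ 1 := by omega
      rw [if_neg a0, if_neg a1, if_pos h]; ring
  have hfac : N * ((m.factorial : ℝ)⁻¹ * D) = (m + 1 : ℕ) * D := by
    have : (m.factorial : ℝ) ≠ 0 := by positivity
    rw [hN, Nat.factorial_succ]; push_cast; field_simp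
  have hR0 : 0 ≤ ∑ s : Finset (Fin (m + 1)), if 2 ≤ s.card then t ^ s.card * c s else 0 := by
    refine Finset.sum_nonneg fun s _ => ?_
    split_ifs
    · exact mul_nonneg (pow_nonneg ht0 _) (hc s)
    · exact le_rfl
  have hR1 : ∑ s : Finset (Fin (m + 1)), (if 2 ≤ s.card then t ^ s.card * c s else 0) ≤
      t ^ 2 * (N * (A + B).det) := by
    have := expand 1
    rw [one_smul] at this
    rw [this, Finset.mul_sum]
    refine Finset.sum_le_sum fun s _ => ?_
    split_ifs with h
    · rw [one_pow, one_mul]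
      exact mul_le_mul_of_nonneg_right (pow_le_pow_of_le_one ht0 ht1 h) (hc s)
    · have := hc s
      simp only [one_pow, one_mul]
      positivity
  have hE := expand t
  rw [split, ← hfac] at hE
  constructor
  · refine le_of_mul_le_mul_left ?_ hNpos
    rw [hE]; linarith
  · refine le_of_mul_le_mul_left ?_ hNpos
    rw [hE]; linarith

end Expansion

/-! ### Support functions -/

namespace ConvexBody

variable {n : ℕ} {K L : ConvexBody (EuclideanSpace ℝ (Fin n))}

theorem inner_le_supportFunction {x : EuclideanSpace ℝ (Fin n)} (hx : x ∈ K)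
    (u : EuclideanSpace ℝ (Fin n)) : inner ℝ x u ≤ K.supportFunction u := by
  refine le_csSup ?_ ⟨x, hx, rfl⟩
  exact (K.isCompact.image (by fun_prop : Continuous fun x => inner ℝ x u)).bddAbove

theorem exists_inner_eq_supportFunction (K : ConvexBody (EuclideanSpace ℝ (Fin n)))
    (u : EuclideanSpace ℝ (Fin n)) : ∃ x ∈ K, inner ℝ x u = K.supportFunction u := by
  have h := (K.isCompact.image (by fun_prop : Continuous fun x => inner ℝ x u)).sSup_mem
    (K.nonempty.image _)
  obtain ⟨x, hx, h⟩ := h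
  exact ⟨x, hx, h⟩

theorem supportFunction_le {u : EuclideanSpace ℝ (Fin n)} {c : ℝ}
    (h : ∀ x ∈ K, inner ℝ x u ≤ c) : K.supportFunction u ≤ c := by
  obtain ⟨x, hx, e⟩ := K.exists_inner_eq_supportFunction u
  exact e ▸ h x hx

@[simp]
theorem supportFunction_zero_body (u : EuclideanSpace ℝ (Fin n)) :
    (0 : ConvexBody (EuclideanSpace ℝ (Fin n))).supportFunction u = 0 := by
  obtain ⟨x, hx, e⟩ := (0 : ConvexBody (EuclideanSpace ℝ (Fin n))).exists_inner_eq_supportFunction u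
  have : x = 0 := by
    rw [← SetLike.mem_coe, coe_zero] at hx; simpa using hx
  rw [← e, this, inner_zero_left]

theorem supportFunction_add_body (K L : ConvexBody (EuclideanSpace ℝ (Fin n)))
    (u : EuclideanSpace ℝ (Fin n)) :
    (K + L).supportFunction u = K.supportFunction u + L.supportFunction u := by
  apply le_antisymm
  · refine supportFunction_le fun x hx => ?_
    rw [← SetLike.mem_coe, coe_add] at hx
    obtain ⟨y, hy, z, hz, rfl⟩ := hx
    rw [inner_add_left]
    exact add_le_add (inner_le_supportFunction hy u) (inner_le_supportFunction hz u)
  · obtain ⟨x, hx, e⟩ := K.exists_inner_eq_supportFunction u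
    obtain ⟨y, hy, e'⟩ := L.exists_inner_eq_supportFunction u
    rw [← e, ← e', ← inner_add_left]
    refine inner_le_supportFunction ?_ u
    rw [← SetLike.mem_coe, coe_add]
    exact Set.add_mem_add hx hy

theorem supportFunction_smul_body (K : ConvexBody (EuclideanSpace ℝ (Fin n))) {c : ℝ} (hc : 0 ≤ c)
    (u : EuclideanSpace ℝ (Fin n)) :
    (c • K).supportFunction u = c * K.supportFunction u := by
  apply le_antisymm
  · refine supportFunction_le fun x hx => ?_
    rw [← SetLike.mem_coe, coe_smul] at hx
    obtain ⟨y, hy, rfl⟩ := hx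
    simp only [inner_smul_left, conj_trivial]
    exact mul_le_mul_of_nonneg_left (inner_le_supportFunction hy u) hc
  · obtain ⟨x, hx, e⟩ := K.exists_inner_eq_supportFunction u
    have : inner ℝ (c • x) u = c * K.supportFunction u := by
      simp only [inner_smul_left, conj_trivial, e]
    rw [← this]
    refine inner_le_supportFunction ?_ u
    rw [← SetLike.mem_coe, coe_smul]
    exact Set.smul_mem_smul_set hx

theorem supportFunction_smul (K : ConvexBody (EuclideanSpace ℝ (Fin n))) {c : ℝ} (hc : 0 ≤ c)
    (u : EuclideanSpace ℝ (Fin n)) :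
    K.supportFunction (c • u) = c * K.supportFunction u := by
  apply le_antisymm
  · refine supportFunction_le fun x hx => ?_
    rw [inner_smul_right]
    exact mul_le_mul_of_nonneg_left (inner_le_supportFunction hx u) hc
  · obtain ⟨x, hx, e⟩ := K.exists_inner_eq_supportFunction u
    rw [← e, ← inner_smul_right]
    exact inner_le_supportFunction hx _

theorem convexOn_supportFunction (K : ConvexBody (EuclideanSpace ℝ (Fin n))) :
    ConvexOn ℝ Set.univ K.supportFunction := by
  refine ⟨convex_univ, fun u _ v _ a b ha hb _ => supportFunction_le fun x hx => ?_⟩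
  rw [inner_add_right, inner_smul_right, inner_smul_right]
  exact add_le_add (mul_le_mul_of_nonneg_left (inner_le_supportFunction hx u) ha)
    (mul_le_mul_of_nonneg_left (inner_le_supportFunction hx v) hb)

theorem exists_lipschitzWith_supportFunction (K : ConvexBody (EuclideanSpace ℝ (Fin n))) :
    ∃ M, LipschitzWith M K.supportFunction := by
  obtain ⟨M, hM⟩ := K.isBounded.exists_norm_le
  have key : ∀ u v, K.supportFunction u ≤ K.supportFunction v + M * dist u v := by
    intro u v
    refine supportFunction_le fun x hx => ?_
    have h1 : inner ℝ x u = inner ℝ x v + inner ℝ x (u - v) := by rw [inner_sub_right]; ring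
    rw [h1, dist_eq_norm]
    refine add_le_add (inner_le_supportFunction hx v) ((real_inner_le_norm _ _).trans ?_)
    exact mul_le_mul_of_nonneg_right (hM x hx) (norm_nonneg _)
  have hM0 : 0 ≤ M := by
    obtain ⟨x, hx⟩ := K.nonempty
    exact (norm_nonneg x).trans (hM x hx)
  exact ⟨⟨M, hM0⟩, LipschitzWith.of_le_add_mul _ key⟩

theorem continuous_supportFunction (K : ConvexBody (EuclideanSpace ℝ (Fin n))) :
    Continuous K.supportFunction :=
  K.exists_lipschitzWith_supportFunction.choose_spec.continuous

/-- A convex body is the intersection of its supporting half-spaces. -/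
theorem mem_of_forall_inner_le {y : EuclideanSpace ℝ (Fin n)}
    (h : ∀ u, inner ℝ y u ≤ K.supportFunction u) : y ∈ K := by
  by_contra hy
  obtain ⟨f, c, hf, hc⟩ := geometric_hahn_banach_closed_point K.convex K.isClosed hy
  set u := (InnerProductSpace.toDual ℝ (EuclideanSpace ℝ (Fin n))).symm f with hu
  have hfu : ∀ x, f x = inner ℝ x u := by
    intro x
    rw [real_inner_comm, hu, InnerProductSpace.toDual_symm_apply]
  have h1 : K.supportFunction u ≤ c := supportFunction_le fun x hx => by
    rw [← hfu]; exact (hf x hx).le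
  have h2 := h u
  rw [← hfu] at h2
  linarith

theorem exists_inner_add_le_of_mem_interior {y : EuclideanSpace ℝ (Fin n)}
    (hy : y ∈ interior (K : Set (EuclideanSpace ℝ (Fin n)))) :
    ∃ r > 0, ∀ u, inner ℝ y u + r * ‖u‖ ≤ K.supportFunction u := by
  rw [mem_interior_iff_mem_nhds, Metric.nhds_basis_closedBall.mem_iff] at hy
  obtain ⟨r, hr, h⟩ := hy
  refine ⟨r, hr, fun u => ?_⟩
  rcases eq_or_ne u 0 with rfl | hu
  · have := inner_le_supportFunction (K := K) (h (Metric.mem_closedBall_self hr.le)) 0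
    simpa using this
  · have hun : ‖u‖ ≠ 0 := norm_ne_zero_iff.mpr hu
    have hm : y + (r / ‖u‖) • u ∈ K := by
      apply h
      rw [Metric.mem_closedBall, dist_eq_norm, add_sub_cancel_left, norm_smul, Real.norm_eq_abs,
        abs_of_nonneg (by positivity), div_mul_cancel₀ _ hun]
    have := inner_le_supportFunction hm u
    rw [inner_add_left, inner_smul_left, conj_trivial, real_inner_self_eq_norm_sq] at this
    have e : r / ‖u‖ * ‖u‖ ^ 2 = r * ‖u‖ := by field_simp
    linarith

end ConvexBody

/-! ### Smooth convex potentials and the gradient map -/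

/-- The Hessian matrix of second partial derivatives. -/
noncomputable def hessianMatrix {n : ℕ} (g : EuclideanSpace ℝ (Fin n) → ℝ)
    (x : EuclideanSpace ℝ (Fin n)) : Matrix (Fin n) (Fin n) ℝ :=
  Matrix.of fun i j => fderiv ℝ (fderiv ℝ g) x (EuclideanSpace.single j 1)
    (EuclideanSpace.single i 1)

/-- A `C²` convex function `g` at bounded distance from the support function of `K`. Its gradient
map parametrizes `K` up to a null set, so that `vol K = ∫ det (Hess g)`. -/
structure ConvexBody.IsPotential {n : ℕ} (K : ConvexBody (EuclideanSpace ℝ (Fin n)))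
    (g : EuclideanSpace ℝ (Fin n) → ℝ) : Prop where
  contDiff : ContDiff ℝ 2 g
  convexOn : ConvexOn ℝ Set.univ g
  bounded : ∃ C, ∀ x, |g x - K.supportFunction x| ≤ C

section Hessian

variable {n : ℕ}

theorem hessianMatrix_zero (x : EuclideanSpace ℝ (Fin n)) :
    hessianMatrix (0 : EuclideanSpace ℝ (Fin n) → ℝ) x = 0 := by
  ext i j
  have : fderiv ℝ (0 : EuclideanSpace ℝ (Fin n) → ℝ) = 0 := by
    funext y; exact fderiv_const_apply (0 : ℝ)
  simp [hessianMatrix, this]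

theorem ContDiff.differentiable_fderiv_two {g : EuclideanSpace ℝ (Fin n) → ℝ}
    (hg : ContDiff ℝ 2 g) : Differentiable ℝ (fderiv ℝ g) :=
  (hg.fderiv_right (m := 1) (by norm_num)).differentiable (by norm_num)

theorem hessianMatrix_add {g h : EuclideanSpace ℝ (Fin n) → ℝ} (hg : ContDiff ℝ 2 g)
    (hh : ContDiff ℝ 2 h) (x : EuclideanSpace ℝ (Fin n)) :
    hessianMatrix (g + h) x = hessianMatrix g x + hessianMatrix h x := by
  ext i j
  have h1 : fderiv ℝ (g + h) = fderiv ℝ g + fderiv ℝ h := by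
    funext y
    exact fderiv_add (hg.differentiable (by norm_num) y) (hh.differentiable (by norm_num) y)
  have h2 := fderiv_add (hg.differentiable_fderiv_two x) (hh.differentiable_fderiv_two x)
  simp [hessianMatrix, h1, h2]

theorem hessianMatrix_const_smul {g : EuclideanSpace ℝ (Fin n) → ℝ} (hg : ContDiff ℝ 2 g) (c : ℝ)
    (x : EuclideanSpace ℝ (Fin n)) :
    hessianMatrix (c • g) x = c • hessianMatrix g x := by
  ext i j
  have h1 : fderiv ℝ (c • g) = c • fderiv ℝ g := by
    funext y
    exact fderiv_const_smul (hg.differentiable (by norm_num) y) c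
  have h2 := fderiv_const_smul (hg.differentiable_fderiv_two x) c
  simp [hessianMatrix, h1, h2]

theorem hessianMatrix_sum {ι : Type*} {g : ι → EuclideanSpace ℝ (Fin n) → ℝ}
    (hg : ∀ i, ContDiff ℝ 2 (g i)) (s : Finset ι) (x : EuclideanSpace ℝ (Fin n)) :
    hessianMatrix (∑ i ∈ s, g i) x = ∑ i ∈ s, hessianMatrix (g i) x := by
  classical
  induction s using Finset.induction_on with
  | empty => simp [hessianMatrix_zero]
  | insert a s ha ih =>
    rw [Finset.sum_insert ha, Finset.sum_insert ha, hessianMatrix_add (hg a), ih]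
    have : (∑ i ∈ s, g i) = fun y => ∑ i ∈ s, g i y := by funext y; simp
    rw [this]
    exact ContDiff.sum fun i _ => hg i

theorem hessianMatrix_congr {g h : EuclideanSpace ℝ (Fin n) → ℝ} {x : EuclideanSpace ℝ (Fin n)}
    (e : g =ᶠ[𝓝 x] h) : hessianMatrix g x = hessianMatrix h x := by
  ext i j
  simp only [hessianMatrix, Matrix.of_apply]
  rw [e.fderiv.fderiv_eq]

theorem continuous_hessianMatrix {g : EuclideanSpace ℝ (Fin n) → ℝ} (hg : ContDiff ℝ 2 g) :
    Continuous (hessianMatrix g) := by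
  have h1 : Continuous (fderiv ℝ (fderiv ℝ g)) :=
    (hg.fderiv_right (m := 1) (by norm_num)).continuous_fderiv (by norm_num)
  refine continuous_matrix fun i j => ?_
  simp only [hessianMatrix, Matrix.of_apply]
  fun_prop

end Hessian

namespace ConvexBody.IsPotential

variable {n : ℕ} {K L : ConvexBody (EuclideanSpace ℝ (Fin n))}
  {g h : EuclideanSpace ℝ (Fin n) → ℝ}

theorem zero : IsPotential (0 : ConvexBody (EuclideanSpace ℝ (Fin n))) 0 :=
  ⟨contDiff_const, convexOn_const 0 convex_univ, 0, fun x => by simp⟩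

theorem add (hg : K.IsPotential g) (hh : L.IsPotential h) : (K + L).IsPotential (g + h) := by
  obtain ⟨C, hC⟩ := hg.bounded
  obtain ⟨D, hD⟩ := hh.bounded
  refine ⟨hg.contDiff.add hh.contDiff, hg.convexOn.add hh.convexOn, C + D, fun x => ?_⟩
  rw [supportFunction_add_body, Pi.add_apply]
  calc |g x + h x - (K.supportFunction x + L.supportFunction x)|
      = |(g x - K.supportFunction x) + (h x - L.supportFunction x)| := by ring_nf
    _ ≤ _ := (abs_add_le _ _).trans (add_le_add (hC x) (hD x))

theorem const_smul (hg : K.IsPotential g) {c : ℝ} (hc : 0 ≤ c) : (c • K).IsPotential (c • g) := by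
  obtain ⟨C, hC⟩ := hg.bounded
  refine ⟨contDiff_const.smul hg.contDiff, hg.convexOn.smul hc, c * C, fun x => ?_⟩
  rw [supportFunction_smul_body _ hc, Pi.smul_apply, smul_eq_mul, ← mul_sub, abs_mul,
    abs_of_nonneg hc]
  exact mul_le_mul_of_nonneg_left (hC x) hc

theorem sum {ι : Type*} {K : ι → ConvexBody (EuclideanSpace ℝ (Fin n))}
    {g : ι → EuclideanSpace ℝ (Fin n) → ℝ} (hg : ∀ i, (K i).IsPotential (g i)) (s : Finset ι) :
    (∑ i ∈ s, K i).IsPotential (∑ i ∈ s, g i) := by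
  classical
  induction s using Finset.induction_on with
  | empty => simpa using zero
  | insert a s ha ih =>
    rw [Finset.sum_insert ha, Finset.sum_insert ha]
    exact (hg a).add ih

end ConvexBody.IsPotential

section GradientMap

variable {n : ℕ} {g : EuclideanSpace ℝ (Fin n) → ℝ}

theorem ConvexOn.add_fderiv_le (hc : ConvexOn ℝ Set.univ g) {x : EuclideanSpace ℝ (Fin n)}
    (hg : DifferentiableAt ℝ g x) (y : EuclideanSpace ℝ (Fin n)) :
    g x + fderiv ℝ g x (y - x) ≤ g y := by
  have h1 : ConvexOn ℝ Set.univ (fun t : ℝ => g (x + t • (y - x))) := by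
    have e : (fun t : ℝ => g (x + t • (y - x))) = g ∘ AffineMap.lineMap (k := ℝ) x y := by
      funext t
      simp [AffineMap.lineMap_apply, add_comm]
    rw [e]
    exact hc.comp_affineMap _
  have h2 : HasDerivAt (fun t : ℝ => g (x + t • (y - x))) (fderiv ℝ g x (y - x)) 0 := by
    have e : HasDerivAt (fun t : ℝ => x + t • (y - x)) (y - x) 0 := by
      simpa using ((hasDerivAt_id (0 : ℝ)).smul_const (y - x)).const_add x
    have hg' : HasFDerivAt g (fderiv ℝ g x) (x + (0 : ℝ) • (y - x)) := by
      simpa using hg.hasFDerivAt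
    exact hg'.comp_hasDerivAt 0 e
  have h3 := h1.le_slope_of_hasDerivAt (Set.mem_univ 0) (Set.mem_univ 1) zero_lt_one h2
  rw [slope_def_field] at h3
  simp only [one_smul, zero_smul, add_zero, add_sub_cancel, sub_zero, div_one] at h3
  linarith

/-- The vector representing a linear functional on Euclidean space. -/
noncomputable def dualVector (n : ℕ) :
    (EuclideanSpace ℝ (Fin n) →L[ℝ] ℝ) →L[ℝ] EuclideanSpace ℝ (Fin n) :=
  ∑ i, (ContinuousLinearMap.apply ℝ ℝ (EuclideanSpace.single i 1)).smulRight
    (EuclideanSpace.single i 1)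

theorem inner_dualVector (f : EuclideanSpace ℝ (Fin n) →L[ℝ] ℝ) (v : EuclideanSpace ℝ (Fin n)) :
    inner ℝ (dualVector n f) v = f v := by
  have e : v = ∑ i, v i • EuclideanSpace.single i (1 : ℝ) := by
    have := (EuclideanSpace.basisFun (Fin n) ℝ).sum_repr v
    simpa using this.symm
  conv_rhs => rw [e]
  simp [dualVector, sum_inner, inner_smul_left, EuclideanSpace.inner_single_left, mul_comm]

/-- The gradient of `g`, as a map of Euclidean space to itself. -/
noncomputable def gradientMap (g : EuclideanSpace ℝ (Fin n) → ℝ) (x : EuclideanSpace ℝ (Fin n)) :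
    EuclideanSpace ℝ (Fin n) :=
  dualVector n (fderiv ℝ g x)

theorem inner_gradientMap (x v : EuclideanSpace ℝ (Fin n)) :
    inner ℝ (gradientMap g x) v = fderiv ℝ g x v :=
  inner_dualVector _ v

/-- The derivative of the gradient map. -/
noncomputable def gradientMapDeriv (g : EuclideanSpace ℝ (Fin n) → ℝ)
    (x : EuclideanSpace ℝ (Fin n)) :
    EuclideanSpace ℝ (Fin n) →L[ℝ] EuclideanSpace ℝ (Fin n) :=
  (dualVector n).comp (fderiv ℝ (fderiv ℝ g) x)

theorem inner_gradientMapDeriv (x v w : EuclideanSpace ℝ (Fin n)) :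
    inner ℝ (gradientMapDeriv g x v) w = fderiv ℝ (fderiv ℝ g) x v w :=
  inner_dualVector _ w

theorem hasFDerivAt_gradientMap (hg : ContDiff ℝ 2 g) (x : EuclideanSpace ℝ (Fin n)) :
    HasFDerivAt (gradientMap g) (gradientMapDeriv g x) x :=
  (dualVector n).hasFDerivAt.comp x (hg.differentiable_fderiv_two x).hasFDerivAt

theorem det_gradientMapDeriv (x : EuclideanSpace ℝ (Fin n)) :
    (gradientMapDeriv g x).det = (hessianMatrix g x).det := by
  have h := LinearMap.det_toMatrix (EuclideanSpace.basisFun (Fin n) ℝ).toBasis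
    (gradientMapDeriv g x : EuclideanSpace ℝ (Fin n) →ₗ[ℝ] EuclideanSpace ℝ (Fin n))
  rw [ContinuousLinearMap.det, ← h]
  congr 1
  ext i j
  rw [LinearMap.toMatrix_apply]
  simp only [OrthonormalBasis.coe_toBasis, EuclideanSpace.basisFun_apply,
    OrthonormalBasis.coe_toBasis_repr_apply, EuclideanSpace.basisFun_repr, hessianMatrix,
    Matrix.of_apply, ContinuousLinearMap.coe_coe]
  rw [← inner_gradientMapDeriv, EuclideanSpace.inner_single_right]
  simp

theorem fderiv_fderiv_self_nonneg (hg : ContDiff ℝ 2 g) (hc : ConvexOn ℝ Set.univ g)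
    (x v : EuclideanSpace ℝ (Fin n)) : 0 ≤ fderiv ℝ (fderiv ℝ g) x v v := by
  have hd : Differentiable ℝ g := hg.differentiable (by norm_num)
  have hmono : Monotone fun t : ℝ => fderiv ℝ g (x + t • v) v := by
    intro s t hst
    rcases hst.eq_or_lt with rfl | hst
    · exact le_rfl
    have h1 := hc.add_fderiv_le (hd (x + s • v)) (x + t • v)
    have h2 := hc.add_fderiv_le (hd (x + t • v)) (x + s • v)
    rw [show x + t • v - (x + s • v) = (t - s) • v by rw [sub_smul]; abel, map_smul,
      smul_eq_mul] at h1
    rw [show x + s • v - (x + t • v) = -((t - s) • v) by rw [sub_smul]; abel, map_neg, map_smul,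
      smul_eq_mul] at h2
    have : (t - s) * fderiv ℝ g (x + s • v) v ≤ (t - s) * fderiv ℝ g (x + t • v) v := by linarith
    exact le_of_mul_le_mul_left this (sub_pos.mpr hst)
  have hder : HasDerivAt (fun t : ℝ => fderiv ℝ g (x + t • v) v)
      (fderiv ℝ (fderiv ℝ g) x v v) 0 := by
    have e : HasDerivAt (fun t : ℝ => x + t • v) v 0 := by
      simpa using ((hasDerivAt_id (0 : ℝ)).smul_const v).const_add x
    have hg' : HasFDerivAt (fderiv ℝ g) (fderiv ℝ (fderiv ℝ g) x) (x + (0 : ℝ) • v) := by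
      simpa using (hg.differentiable_fderiv_two x).hasFDerivAt
    have := (hg'.comp_hasDerivAt 0 e)
    exact ((ContinuousLinearMap.apply ℝ ℝ v).hasFDerivAt).comp_hasDerivAt 0 this
  rw [← hder.deriv]
  exact hmono.deriv_nonneg

theorem posSemidef_hessianMatrix (hg : ContDiff ℝ 2 g) (hc : ConvexOn ℝ Set.univ g)
    (x : EuclideanSpace ℝ (Fin n)) : (hessianMatrix g x).PosSemidef := by
  refine Matrix.PosSemidef.of_dotProduct_mulVec_nonneg ?_ fun v => ?_
  · ext i j
    have := (hg.contDiffAt (x := x)).isSymmSndFDerivAt (by simp)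
    simp only [hessianMatrix, Matrix.conjTranspose_apply, Matrix.of_apply, star_trivial]
    exact this _ _
  · have h := fderiv_fderiv_self_nonneg hg hc x (WithLp.toLp 2 v)
    have e : (WithLp.toLp 2 v : EuclideanSpace ℝ (Fin n)) =
        ∑ i, v i • EuclideanSpace.single i (1 : ℝ) := by
      have := (EuclideanSpace.basisFun (Fin n) ℝ).sum_repr (WithLp.toLp 2 v)
      simpa using this.symm
    rw [e] at h
    refine le_of_le_of_eq h ?_
    simp only [map_sum, map_smul, hessianMatrix, dotProduct, Matrix.mulVec, Matrix.of_apply,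
      star_trivial, _root_.sum_apply, _root_.smul_apply, smul_eq_mul,
      Finset.mul_sum]
    refine Finset.sum_congr rfl fun i _ => Finset.sum_congr rfl fun j _ => ?_
    ring

end GradientMap

namespace ConvexBody.IsPotential

variable {n : ℕ} {K : ConvexBody (EuclideanSpace ℝ (Fin n))}
  {g : EuclideanSpace ℝ (Fin n) → ℝ}

theorem differentiable (hg : K.IsPotential g) : Differentiable ℝ g :=
  hg.contDiff.differentiable (by norm_num)

theorem gradientMap_mem (hg : K.IsPotential g) (x : EuclideanSpace ℝ (Fin n)) :
    gradientMap g x ∈ K := by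
  refine mem_of_forall_inner_le fun v => ?_
  obtain ⟨C, hC⟩ := hg.bounded
  rw [inner_gradientMap]
  by_contra! hlt
  -- the slope of `g` along the ray from `x` in direction `v` cannot exceed its growth rate
  set d := fderiv ℝ g x v - K.supportFunction v with hd
  have hdpos : 0 < d := sub_pos.mpr hlt
  have key : ∀ t : ℝ, 0 ≤ t → t * d ≤ K.supportFunction x + C - g x := by
    intro t ht
    have h1 := hg.convexOn.add_fderiv_le (hg.differentiable x) (x + t • v)
    rw [add_sub_cancel_left, map_smul, smul_eq_mul] at h1
    have h2 := (abs_le.mp (hC (x + t • v))).2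
    have h3 : K.supportFunction (x + t • v) ≤ K.supportFunction x + t * K.supportFunction v := by
      rw [← supportFunction_smul K ht]
      refine supportFunction_le fun y hy => ?_
      rw [inner_add_right]
      exact add_le_add (inner_le_supportFunction hy _) (inner_le_supportFunction hy _)
    rw [hd]
    linarith
  set D := K.supportFunction x + C - g x
  have h4 := key ((|D| + 1) / d) (by positivity)
  rw [div_mul_cancel₀ _ hdpos.ne'] at h4
  have := le_abs_self D
  linarith

theorem exists_gradientMap_eq (hg : K.IsPotential g) {y : EuclideanSpace ℝ (Fin n)}
    (hy : y ∈ interior (K : Set (EuclideanSpace ℝ (Fin n)))) : ∃ x, gradientMap g x = y := by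
  obtain ⟨C, hC⟩ := hg.bounded
  obtain ⟨r, hr, h⟩ := exists_inner_add_le_of_mem_interior hy
  have hcoer : Tendsto (fun x => g x - inner ℝ y x) (cocompact _) atTop := by
    have h1 : Tendsto (fun x : EuclideanSpace ℝ (Fin n) => r * ‖x‖ - C) (cocompact _) atTop :=
      tendsto_atTop_add_const_right _ (-C) (tendsto_norm_cocompact_atTop.const_mul_atTop hr)
    refine tendsto_atTop_mono (fun x => ?_) h1
    have := (abs_le.mp (hC x)).1
    have := h x
    linarith
  have hcont : Continuous fun x => g x - inner ℝ y x :=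
    hg.contDiff.continuous.sub (by fun_prop)
  obtain ⟨x, hx⟩ := hcont.exists_forall_le hcoer
  refine ⟨x, ?_⟩
  have hmin : IsLocalMin (fun x => g x - inner ℝ y x) x := Eventually.of_forall hx
  have hder : HasFDerivAt (fun x => g x - inner ℝ y x) (fderiv ℝ g x - innerSL ℝ y) x :=
    (hg.differentiable x).hasFDerivAt.sub (innerSL ℝ y).hasFDerivAt
  have h0 := hmin.hasFDerivAt_eq_zero hder
  refine ext_inner_right ℝ fun v => ?_
  rw [inner_gradientMap]
  have := congrArg (fun f => f v) h0
  simp at this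
  linarith

/-- The gradient map is injective where its derivative is invertible: the points with a given
gradient minimize the convex function `g - ⟨y, ·⟩`, so they form a convex set, and the derivative of
the gradient map vanishes along it. -/
theorem injOn_gradientMap (hg : K.IsPotential g) :
    Set.InjOn (gradientMap g) {x | (gradientMapDeriv g x).det ≠ 0} := by
  intro x hx x' _ he
  by_contra hne
  apply hx
  have hseg : ∀ t : ℝ, 0 ≤ t → t ≤ 1 → gradientMap g (x + t • (x' - x)) = gradientMap g x := by
    intro t ht0 ht1
    set z := x + t • (x' - x) with hz
    have hmin : ∀ w, g z + fderiv ℝ g x (w - z) ≤ g w := by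
      intro w
      have h1 := hg.convexOn.add_fderiv_le (hg.differentiable x) w
      have h2 := hg.convexOn.add_fderiv_le (hg.differentiable x') w
      have hf : fderiv ℝ g x' = fderiv ℝ g x := by
        ext v; rw [← inner_gradientMap, ← inner_gradientMap, he]
      rw [hf] at h2
      have h3 := hg.convexOn.2 (Set.mem_univ x) (Set.mem_univ x') (sub_nonneg.mpr ht1) ht0
        (by ring)
      rw [show (1 - t) • x + t • x' = z by rw [hz]; module] at h3
      simp only [smul_eq_mul] at h3
      have e : fderiv ℝ g x (w - z) =
          (1 - t) * fderiv ℝ g x (w - x) + t * fderiv ℝ g x (w - x') := by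
        rw [← smul_eq_mul, ← smul_eq_mul, ← map_smul, ← map_smul, ← map_add]
        congr 1
        rw [hz]; module
      rw [e]
      nlinarith
    have hlm : IsLocalMin (fun w => g w - fderiv ℝ g x w) z := by
      refine Eventually.of_forall fun w => ?_
      have := hmin w
      rw [map_sub] at this
      simp only
      linarith
    have hder : HasFDerivAt (fun w => g w - fderiv ℝ g x w) (fderiv ℝ g z - fderiv ℝ g x) z :=
      (hg.differentiable z).hasFDerivAt.sub (fderiv ℝ g x).hasFDerivAt
    have h0 := sub_eq_zero.mp (hlm.hasFDerivAt_eq_zero hder)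
    rw [gradientMap, h0, gradientMap]
  have hzero : gradientMapDeriv g x (x' - x) = 0 := by
    have e : HasDerivAt (fun t : ℝ => x + t • (x' - x)) (x' - x) 0 := by
      simpa using ((hasDerivAt_id (0 : ℝ)).smul_const (x' - x)).const_add x
    have hg' : HasFDerivAt (gradientMap g) (gradientMapDeriv g x) (x + (0 : ℝ) • (x' - x)) := by
      simpa using hasFDerivAt_gradientMap hg.contDiff x
    have h1 := (hg'.comp_hasDerivAt 0 e).hasDerivWithinAt (s := Set.Icc 0 1)
    have h2 : HasDerivWithinAt (gradientMap g ∘ fun t : ℝ => x + t • (x' - x)) 0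
        (Set.Icc 0 1) 0 := by
      refine (hasDerivWithinAt_const (0 : ℝ) (Set.Icc 0 1) (gradientMap g x)).congr ?_ ?_
      · intro t ht; exact hseg t ht.1 ht.2
      · exact hseg 0 le_rfl zero_le_one
    exact (uniqueDiffOn_Icc zero_lt_one 0 (by simp)).eq_deriv _ h1 h2
  by_contra hdet
  have hdet' : LinearMap.det (gradientMapDeriv g x :
    EuclideanSpace ℝ (Fin n) →ₗ[ℝ] EuclideanSpace ℝ (Fin n)) ≠ 0 := hdet
  have hker := LinearMap.ker_eq_bot.mp
    (LinearMap.isUnit_iff_ker_eq_bot _ |>.mp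
      ((LinearMap.isUnit_iff_isUnit_det _).mpr hdet'.isUnit))
  apply hne
  have : x' - x = 0 := hker (by simpa using hzero)
  exact (sub_eq_zero.mp this).symm

theorem det_hessianMatrix_nonneg (hg : K.IsPotential g) (x : EuclideanSpace ℝ (Fin n)) :
    0 ≤ (hessianMatrix g x).det :=
  (posSemidef_hessianMatrix hg.contDiff hg.convexOn x).det_nonneg

theorem lintegral_det_hessianMatrix (hg : K.IsPotential g) :
    ∫⁻ x, ENNReal.ofReal (hessianMatrix g x).det =
      volume (K : Set (EuclideanSpace ℝ (Fin n))) := by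
  set A : Set (EuclideanSpace ℝ (Fin n)) := {x | (gradientMapDeriv g x).det ≠ 0} with hA
  have hcont : Continuous fun x => (hessianMatrix g x).det :=
    (continuous_hessianMatrix hg.contDiff).matrix_det
  have hAm : MeasurableSet A := by
    have : A = {x | (hessianMatrix g x).det ≠ 0} := by
      ext x; simp [hA, det_gradientMapDeriv]
    rw [this]
    exact (isOpen_ne_fun hcont continuous_const).measurableSet
  have h1 : ∫⁻ x, ENNReal.ofReal (hessianMatrix g x).det =
      ∫⁻ x in A, ENNReal.ofReal |(gradientMapDeriv g x).det| := by
    rw [← lintegral_indicator hAm]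
    refine lintegral_congr fun x => ?_
    by_cases hx : x ∈ A
    · rw [Set.indicator_of_mem hx, det_gradientMapDeriv,
        abs_of_nonneg (hg.det_hessianMatrix_nonneg x)]
    · rw [Set.indicator_of_notMem hx]
      have : (gradientMapDeriv g x).det = 0 := not_not.mp hx
      rw [← det_gradientMapDeriv, this, ENNReal.ofReal_zero]
  rw [h1, lintegral_abs_det_fderiv_eq_addHaar_image volume hAm
    (fun x _ => (hasFDerivAt_gradientMap hg.contDiff x).hasFDerivWithinAt) hg.injOn_gradientMap]
  have h2 : volume (gradientMap g '' Aᶜ) = 0 :=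
    addHaar_image_eq_zero_of_det_fderivWithin_eq_zero volume
      (fun x _ => (hasFDerivAt_gradientMap hg.contDiff x).hasFDerivWithinAt)
      (fun x hx => not_not.mp hx)
  apply le_antisymm
  · refine measure_mono ?_
    rintro _ ⟨x, -, rfl⟩
    exact hg.gradientMap_mem x
  · have h3 : (K : Set (EuclideanSpace ℝ (Fin n))) ⊆
        (gradientMap g '' A ∪ gradientMap g '' Aᶜ) ∪
          frontier (K : Set (EuclideanSpace ℝ (Fin n))) := by
      intro y hy
      by_cases hi : y ∈ interior (K : Set (EuclideanSpace ℝ (Fin n)))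
      · left
        obtain ⟨x, rfl⟩ := hg.exists_gradientMap_eq hi
        rw [← Set.image_union, Set.union_compl_self]
        exact ⟨x, Set.mem_univ _, rfl⟩
      · right
        exact ⟨subset_closure hy, hi⟩
    calc volume (K : Set (EuclideanSpace ℝ (Fin n)))
        ≤ _ := measure_mono h3
      _ ≤ _ := measure_union_le _ _
      _ ≤ (volume (gradientMap g '' A) + volume (gradientMap g '' Aᶜ)) + 0 := by
          rw [K.convex.addHaar_frontier volume]
          gcongr
          exact measure_union_le _ _
      _ = _ := by rw [h2]; simp

theorem integrable_det_hessianMatrix (hg : K.IsPotential g) :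
    Integrable fun x => (hessianMatrix g x).det := by
  have hcont : Continuous fun x => (hessianMatrix g x).det :=
    (continuous_hessianMatrix hg.contDiff).matrix_det
  refine ⟨hcont.aestronglyMeasurable, ?_⟩
  rw [hasFiniteIntegral_iff_ofReal (Eventually.of_forall hg.det_hessianMatrix_nonneg),
    hg.lintegral_det_hessianMatrix]
  exact K.isCompact.measure_lt_top

/-- The volume of `K` is the total Monge–Ampère mass of any of its potentials. -/
theorem integral_det_hessianMatrix (hg : K.IsPotential g) :
    ∫ x, (hessianMatrix g x).det = volume.real (K : Set (EuclideanSpace ℝ (Fin n))) := by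
  have hcont : Continuous fun x => (hessianMatrix g x).det :=
    (continuous_hessianMatrix hg.contDiff).matrix_det
  rw [integral_eq_lintegral_of_nonneg_ae (Eventually.of_forall hg.det_hessianMatrix_nonneg)
    hcont.aestronglyMeasurable, hg.lintegral_det_hessianMatrix]
  rfl

end ConvexBody.IsPotential

/-! ### Mollification of support functions -/

section Mollify

variable {n : ℕ} {w : EuclideanSpace ℝ (Fin n) → ℝ}

/-- A fixed smooth probability density supported in the ball of radius `2`. -/
noncomputable def mollifierKernel (n : ℕ) : EuclideanSpace ℝ (Fin n) → ℝ :=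
  (⟨1, 2, one_pos, one_lt_two⟩ : ContDiffBump (0 : EuclideanSpace ℝ (Fin n))).normed volume

theorem mollifierKernel_nonneg (t : EuclideanSpace ℝ (Fin n)) : 0 ≤ mollifierKernel n t :=
  ContDiffBump.nonneg_normed _ _

theorem continuous_mollifierKernel : Continuous (mollifierKernel n) :=
  ContDiffBump.continuous_normed _

theorem hasCompactSupport_mollifierKernel : HasCompactSupport (mollifierKernel n) :=
  ContDiffBump.hasCompactSupport_normed _

theorem integral_mollifierKernel : ∫ t, mollifierKernel n t = 1 :=
  ContDiffBump.integral_normed _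

theorem norm_lt_two_of_mollifierKernel_ne_zero {t : EuclideanSpace ℝ (Fin n)}
    (ht : mollifierKernel n t ≠ 0) : ‖t‖ < 2 := by
  have : t ∈ Function.support (mollifierKernel n) := ht
  rw [mollifierKernel, ContDiffBump.support_normed_eq] at this
  simpa using this

/-- The convolution of `w` with the mollifier kernel. -/
noncomputable def mollify (w : EuclideanSpace ℝ (Fin n) → ℝ) (x : EuclideanSpace ℝ (Fin n)) : ℝ :=
  ∫ t, mollifierKernel n t * w (x - t)

theorem integrable_mollify (hw : Continuous w) (x : EuclideanSpace ℝ (Fin n)) :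
    Integrable fun t => mollifierKernel n t * w (x - t) := by
  have := @continuous_mollifierKernel n
  refine Continuous.integrable_of_hasCompactSupport (by fun_prop) ?_
  exact hasCompactSupport_mollifierKernel.mul_right

theorem contDiff_mollify (hw : Continuous w) : ContDiff ℝ 2 (mollify w) := by
  have h := HasCompactSupport.contDiff_convolution_left (𝕜 := ℝ) (n := 2) (μ := volume)
    (ContinuousLinearMap.mul ℝ ℝ) (hasCompactSupport_mollifierKernel (n := n))
    (ContDiffBump.contDiff_normed _) hw.locallyIntegrable
  exact h

theorem convexOn_mollify (hw : Continuous w) (hc : ConvexOn ℝ Set.univ w) :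
    ConvexOn ℝ Set.univ (mollify w) := by
  refine ⟨convex_univ, fun x _ y _ a b ha hb hab => ?_⟩
  simp only [mollify, smul_eq_mul]
  rw [← integral_const_mul, ← integral_const_mul,
    ← integral_add ((integrable_mollify hw x).const_mul a) ((integrable_mollify hw y).const_mul b)]
  refine integral_mono (integrable_mollify hw _)
    (((integrable_mollify hw x).const_mul a).add ((integrable_mollify hw y).const_mul b))
    fun t => ?_
  have h1 := hc.2 (Set.mem_univ (x - t)) (Set.mem_univ (y - t)) ha hb hab
  have e : a • (x - t) + b • (y - t) = a • x + b • y - t := by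
    have : t = (a + b) • t := by rw [hab, one_smul]
    conv_rhs => rw [this]
    module
  rw [e, smul_eq_mul, smul_eq_mul] at h1
  have := mul_le_mul_of_nonneg_left h1 (mollifierKernel_nonneg t)
  simp only
  linarith

theorem abs_mollify_sub_le {M : NNReal} (hL : LipschitzWith M w) (x : EuclideanSpace ℝ (Fin n)) :
    |mollify w x - w x| ≤ M * 2 := by
  have hi : Integrable (mollifierKernel n) :=
    continuous_mollifierKernel.integrable_of_hasCompactSupport hasCompactSupport_mollifierKernel
  have e : mollify w x - w x = ∫ t, mollifierKernel n t * (w (x - t) - w x) := by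
    simp_rw [mul_sub]
    rw [integral_sub (integrable_mollify hL.continuous x) (hi.mul_const _), integral_mul_const,
      integral_mollifierKernel, one_mul]
    rfl
  rw [e, ← Real.norm_eq_abs]
  have h2 : ∫ t, mollifierKernel n t * ((M : ℝ) * 2) = M * 2 := by
    rw [integral_mul_const, integral_mollifierKernel, one_mul]
  rw [← h2]
  refine norm_integral_le_of_norm_le (hi.mul_const _) (Eventually.of_forall fun t => ?_)
  rw [norm_mul, Real.norm_of_nonneg (mollifierKernel_nonneg t)]
  by_cases ht : mollifierKernel n t = 0
  · simp [ht]
  refine mul_le_mul_of_nonneg_left ?_ (mollifierKernel_nonneg t)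
  have h3 := hL.dist_le_mul (x - t) x
  rw [Real.dist_eq, dist_eq_norm, sub_sub_cancel_left, norm_neg] at h3
  exact h3.trans (mul_le_mul_of_nonneg_left (norm_lt_two_of_mollifierKernel_ne_zero ht).le M.2)

theorem mollify_congr {v : EuclideanSpace ℝ (Fin n) → ℝ} {x : EuclideanSpace ℝ (Fin n)}
    (h : ∀ t, ‖t‖ < 2 → w (x - t) = v (x - t)) : mollify w x = mollify v x := by
  refine integral_congr_ae (Eventually.of_forall fun t => ?_)
  by_cases ht : mollifierKernel n t = 0
  · simp [ht]
  · simp only [h t (norm_lt_two_of_mollifierKernel_ne_zero ht)]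

namespace ConvexBody

variable {K : ConvexBody (EuclideanSpace ℝ (Fin n))}

theorem isPotential_mollify {M : NNReal} (hL : LipschitzWith M w) (hc : ConvexOn ℝ Set.univ w)
    {C : ℝ} (hC : ∀ x, |w x - K.supportFunction x| ≤ C) : K.IsPotential (mollify w) := by
  refine ⟨contDiff_mollify hL.continuous, convexOn_mollify hL.continuous hc, M * 2 + C,
    fun x => ?_⟩
  exact (abs_sub_le _ (w x) _).trans (add_le_add (abs_mollify_sub_le hL x) (hC x))

/-- The mollified support function, the standard potential of `K`. -/
noncomputable def potential (K : ConvexBody (EuclideanSpace ℝ (Fin n))) :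
    EuclideanSpace ℝ (Fin n) → ℝ :=
  mollify K.supportFunction

theorem isPotential_potential (K : ConvexBody (EuclideanSpace ℝ (Fin n))) :
    K.IsPotential K.potential :=
  isPotential_mollify K.exists_lipschitzWith_supportFunction.choose_spec
    K.convexOn_supportFunction (C := 0) (by simp)

end ConvexBody

end Mollify

/-! ### Mixed volumes as integrals of mixed discriminants -/

namespace ConvexBody

theorem integrable_mixedDet {n : ℕ} {K : Fin n → ConvexBody (EuclideanSpace ℝ (Fin n))}
    {g : Fin n → EuclideanSpace ℝ (Fin n) → ℝ} (hg : ∀ i, (K i).IsPotential (g i)) :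
    Integrable fun x => Matrix.mixedDet fun i => hessianMatrix (g i) x := by
  simp_rw [← Matrix.sum_neg_one_pow_card_det]
  refine integrable_finsetSum _ fun I _ => Integrable.const_mul ?_ _
  have h := (IsPotential.sum hg I).integrable_det_hessianMatrix
  simpa only [hessianMatrix_sum fun i => (hg i).contDiff] using h

theorem factorial_mul_mixedVolume {n : ℕ} {K : Fin n → ConvexBody (EuclideanSpace ℝ (Fin n))}
    {g : Fin n → EuclideanSpace ℝ (Fin n) → ℝ} (hg : ∀ i, (K i).IsPotential (g i)) :
    (n.factorial : ℝ) * mixedVolume K = ∫ x, Matrix.mixedDet fun i => hessianMatrix (g i) x := by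
  have hn : (n.factorial : ℝ) ≠ 0 := by positivity
  rw [mixedVolume, ← mul_assoc, mul_inv_cancel₀ hn, one_mul]
  simp_rw [← Matrix.sum_neg_one_pow_card_det, Fintype.card_fin]
  have hi : ∀ I : Finset (Fin n), Integrable fun x => (∑ i ∈ I, hessianMatrix (g i) x).det := by
    intro I
    have h := (IsPotential.sum hg I).integrable_det_hessianMatrix
    simpa only [hessianMatrix_sum fun i => (hg i).contDiff] using h
  rw [integral_finsetSum _ fun I _ => (hi I).const_mul _]
  refine Finset.sum_congr rfl fun I _ => ?_
  rw [integral_const_mul, ← (IsPotential.sum hg I).integral_det_hessianMatrix]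
  simp_rw [hessianMatrix_sum fun i => (hg i).contDiff]

variable {m : ℕ}

/-- The mixed volume `V(P₁, …, P_{n-1}, L)`, with a distinguished last body. -/
noncomputable def mixedVolumeLast (P : Fin m → ConvexBody (EuclideanSpace ℝ (Fin (m + 1))))
    (L : ConvexBody (EuclideanSpace ℝ (Fin (m + 1)))) : ℝ :=
  mixedVolume (Fin.snoc (α := fun _ => ConvexBody (EuclideanSpace ℝ (Fin (m + 1)))) P L)

/-- The integrand of `n! V(P₁, …, P_{n-1}, L)` for potentials `g` of `P` and `f` of `L`. -/
noncomputable def mixedHessianDet (g : Fin m → EuclideanSpace ℝ (Fin (m + 1)) → ℝ)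
    (f : EuclideanSpace ℝ (Fin (m + 1)) → ℝ) (x : EuclideanSpace ℝ (Fin (m + 1))) : ℝ :=
  Matrix.mixedDet (Fin.snoc (α := fun _ => Matrix (Fin (m + 1)) (Fin (m + 1)) ℝ)
    (fun i => hessianMatrix (g i) x) (hessianMatrix f x))

variable {P : Fin m → ConvexBody (EuclideanSpace ℝ (Fin (m + 1)))}
  {L L' : ConvexBody (EuclideanSpace ℝ (Fin (m + 1)))}
  {g : Fin m → EuclideanSpace ℝ (Fin (m + 1)) → ℝ}
  {f f' : EuclideanSpace ℝ (Fin (m + 1)) → ℝ}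

theorem isPotential_snoc (hg : ∀ i, (P i).IsPotential (g i)) (hf : L.IsPotential f)
    (i : Fin (m + 1)) :
    (Fin.snoc (α := fun _ => ConvexBody (EuclideanSpace ℝ (Fin (m + 1)))) P L i).IsPotential
      (Fin.snoc (α := fun _ => EuclideanSpace ℝ (Fin (m + 1)) → ℝ) g f i) := by
  refine Fin.lastCases ?_ (fun j => ?_) i
  · simpa using hf
  · simpa using hg j

theorem hessianMatrix_snoc (x : EuclideanSpace ℝ (Fin (m + 1))) :
    (fun i => hessianMatrix (Fin.snoc (α := fun _ => EuclideanSpace ℝ (Fin (m + 1)) → ℝ) g f i) x)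
      = Fin.snoc (α := fun _ => Matrix (Fin (m + 1)) (Fin (m + 1)) ℝ)
        (fun i => hessianMatrix (g i) x) (hessianMatrix f x) := by
  funext i
  refine Fin.lastCases ?_ (fun j => ?_) i <;> simp

theorem integrable_mixedHessianDet (hg : ∀ i, (P i).IsPotential (g i)) (hf : L.IsPotential f) :
    Integrable (mixedHessianDet g f) := by
  have h := integrable_mixedDet (isPotential_snoc hg hf)
  simpa only [hessianMatrix_snoc] using! h

theorem factorial_mul_mixedVolumeLast (hg : ∀ i, (P i).IsPotential (g i)) (hf : L.IsPotential f) :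
    ((m + 1).factorial : ℝ) * mixedVolumeLast P L = ∫ x, mixedHessianDet g f x := by
  rw [mixedVolumeLast, factorial_mul_mixedVolume (isPotential_snoc hg hf)]
  simp_rw [hessianMatrix_snoc]
  rfl

theorem mixedHessianDet_nonneg (hg : ∀ i, (P i).IsPotential (g i)) (hf : L.IsPotential f)
    (x : EuclideanSpace ℝ (Fin (m + 1))) : 0 ≤ mixedHessianDet g f x := by
  refine Matrix.mixedDet_nonneg _ fun i => ?_
  refine Fin.lastCases ?_ (fun j => ?_) i
  · simpa using posSemidef_hessianMatrix hf.contDiff hf.convexOn x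
  · simpa using posSemidef_hessianMatrix (hg j).contDiff (hg j).convexOn x

theorem mixedVolumeLast_add (P : Fin m → ConvexBody (EuclideanSpace ℝ (Fin (m + 1))))
    (L L' : ConvexBody (EuclideanSpace ℝ (Fin (m + 1)))) :
    mixedVolumeLast P (L + L') = mixedVolumeLast P L + mixedVolumeLast P L' := by
  have hP := fun i => (P i).isPotential_potential
  have hL := L.isPotential_potential
  have hL' := L'.isPotential_potential
  have h0 : ((m + 1).factorial : ℝ) ≠ 0 := by positivity
  refine mul_left_cancel₀ h0 ?_
  rw [mul_add, factorial_mul_mixedVolumeLast hP hL, factorial_mul_mixedVolumeLast hP hL',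
    factorial_mul_mixedVolumeLast hP (hL.add hL'), ← integral_add
      (integrable_mixedHessianDet hP hL) (integrable_mixedHessianDet hP hL')]
  refine integral_congr_ae (Eventually.of_forall fun x => ?_)
  simp only [mixedHessianDet, hessianMatrix_add hL.contDiff hL'.contDiff]
  have h := Matrix.mixedDet.map_update_add (Fin.snoc (α := fun _ => Matrix (Fin (m + 1))
    (Fin (m + 1)) ℝ) (fun i => hessianMatrix ((P i).potential) x) 0) (Fin.last m)
    (hessianMatrix L.potential x) (hessianMatrix L'.potential x)
  simpa only [Fin.update_snoc_last] using h

theorem mixedVolumeLast_smul (P : Fin m → ConvexBody (EuclideanSpace ℝ (Fin (m + 1))))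
    (L : ConvexBody (EuclideanSpace ℝ (Fin (m + 1)))) {c : ℝ} (hc : 0 ≤ c) :
    mixedVolumeLast P (c • L) = c * mixedVolumeLast P L := by
  have hP := fun i => (P i).isPotential_potential
  have hL := L.isPotential_potential
  have h0 : ((m + 1).factorial : ℝ) ≠ 0 := by positivity
  refine mul_left_cancel₀ h0 ?_
  rw [mul_left_comm, factorial_mul_mixedVolumeLast hP hL,
    factorial_mul_mixedVolumeLast hP (hL.const_smul hc), ← integral_const_mul]
  refine integral_congr_ae (Eventually.of_forall fun x => ?_)
  simp only [mixedHessianDet, hessianMatrix_const_smul hL.contDiff]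
  have h := Matrix.mixedDet.map_update_smul (Fin.snoc (α := fun _ => Matrix (Fin (m + 1))
    (Fin (m + 1)) ℝ) (fun i => hessianMatrix ((P i).potential) x) 0) (Fin.last m)
    c (hessianMatrix L.potential x)
  simpa only [Fin.update_snoc_last, smul_eq_mul] using h

/-- Polarization in the first `n - 1` arguments of the mixed volume. -/
theorem sum_neg_one_pow_card_mixedVolumeLast
    (P : Fin m → ConvexBody (EuclideanSpace ℝ (Fin (m + 1))))
    (L : ConvexBody (EuclideanSpace ℝ (Fin (m + 1)))) :
    ∑ I : Finset (Fin m), (-1 : ℝ) ^ (m - I.card) * mixedVolumeLast (fun _ => ∑ i ∈ I, P i) L =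
      (m.factorial : ℝ) * mixedVolumeLast P L := by
  have hP := fun i => (P i).isPotential_potential
  have hL := L.isPotential_potential
  have hPI := fun I : Finset (Fin m) => fun _ : Fin m => IsPotential.sum hP I
  have h0 : ((m + 1).factorial : ℝ) ≠ 0 := by positivity
  refine mul_left_cancel₀ h0 ?_
  rw [mul_left_comm, factorial_mul_mixedVolumeLast hP hL, Finset.mul_sum, ← integral_const_mul]
  simp_rw [mul_left_comm ((m + 1).factorial : ℝ), factorial_mul_mixedVolumeLast (hPI _) hL,
    ← integral_const_mul]
  rw [← integral_finsetSum _ fun I _ => (integrable_mixedHessianDet (hPI I) hL).const_mul _]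
  refine integral_congr_ae (Eventually.of_forall fun x => ?_)
  simp only [mixedHessianDet, hessianMatrix_sum fun i => (hP i).contDiff]
  exact Matrix.sum_neg_one_pow_card_mixedDet_snoc _ _

/-- Second order control of `t ↦ vol (K + t L)` at `0`, whose derivative there is
`n V(K, …, K, L)`. -/
theorem volume_add_smul_bounds (K L : ConvexBody (EuclideanSpace ℝ (Fin (m + 1)))) {t : ℝ}
    (ht0 : 0 ≤ t) (ht1 : t ≤ 1) :
    volume.real (K : Set (EuclideanSpace ℝ (Fin (m + 1)))) +
        t * ((m + 1 : ℕ) * mixedVolumeLast (fun _ : Fin m => K) L) ≤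
      volume.real ((K + t • L : ConvexBody _) : Set (EuclideanSpace ℝ (Fin (m + 1)))) ∧
    volume.real ((K + t • L : ConvexBody _) : Set (EuclideanSpace ℝ (Fin (m + 1)))) ≤
      volume.real (K : Set (EuclideanSpace ℝ (Fin (m + 1)))) +
        t * ((m + 1 : ℕ) * mixedVolumeLast (fun _ : Fin m => K) L) +
      t ^ 2 * volume.real ((K + L : ConvexBody _) : Set (EuclideanSpace ℝ (Fin (m + 1)))) := by
  have hK := K.isPotential_potential
  have hL := L.isPotential_potential
  have hM : ((m + 1 : ℕ) : ℝ) * mixedVolumeLast (fun _ : Fin m => K) L =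
      (m.factorial : ℝ)⁻¹ * ∫ x, mixedHessianDet (fun _ : Fin m => K.potential) L.potential x := by
    rw [← factorial_mul_mixedVolumeLast (fun _ => hK) hL, Nat.factorial_succ]
    have : (m.factorial : ℝ) ≠ 0 := by positivity
    push_cast; field_simp
  have iK := hK.integrable_det_hessianMatrix
  have iM := ((integrable_mixedHessianDet (fun _ : Fin m => hK) hL).const_mul
    (m.factorial : ℝ)⁻¹).const_mul t
  have iKM : Integrable fun x => (hessianMatrix K.potential x).det + t * ((m.factorial : ℝ)⁻¹ *
      mixedHessianDet (fun _ : Fin m => K.potential) L.potential x) := iK.add iM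
  have iT := (hK.add (hL.const_smul ht0)).integrable_det_hessianMatrix
  have iS := (hK.add hL).integrable_det_hessianMatrix.const_mul (t ^ 2)
  have hb := fun x => Matrix.det_add_smul_bounds _ _
    (posSemidef_hessianMatrix hK.contDiff hK.convexOn x)
    (posSemidef_hessianMatrix hL.contDiff hL.convexOn x) t ht0 ht1
  have eT : ∀ x, hessianMatrix (K.potential + t • L.potential) x =
      hessianMatrix K.potential x + t • hessianMatrix L.potential x := by
    intro x
    rw [hessianMatrix_add hK.contDiff (hL.const_smul ht0).contDiff,
      hessianMatrix_const_smul hL.contDiff]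
  have eS : ∀ x, hessianMatrix (K.potential + L.potential) x =
      hessianMatrix K.potential x + hessianMatrix L.potential x :=
    hessianMatrix_add hK.contDiff hL.contDiff
  rw [hM, ← hK.integral_det_hessianMatrix,
    ← (hK.add (hL.const_smul ht0)).integral_det_hessianMatrix,
    ← (hK.add hL).integral_det_hessianMatrix, ← integral_const_mul, ← integral_const_mul,
    ← integral_const_mul, ← integral_add iK iM, ← integral_add iKM iS]
  constructor
  · refine integral_mono iKM iT fun x => ?_
    simp only [eT]
    exact (hb x).1
  · refine integral_mono iT (iKM.add iS) fun x => ?_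
    simp only [eT, eS]
    exact (hb x).2

/-- Monotonicity of the mixed volume in its last argument. The proof compares potentials: for large
`c` the maximum of `h_L` and `h_{L'} - c` yields a potential of `L'` that coincides with the one of
`L` on a large ball, and the mixed discriminants are nonnegative outside it. -/
theorem mixedVolumeLast_mono (P : Fin m → ConvexBody (EuclideanSpace ℝ (Fin (m + 1))))
    (h : ∀ u, L.supportFunction u ≤ L'.supportFunction u) :
    mixedVolumeLast P L ≤ mixedVolumeLast P L' := by
  have hP := fun i => (P i).isPotential_potential
  have hL := L.isPotential_potential
  have h0 : (0 : ℝ) < ((m + 1).factorial : ℝ) := by positivity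
  refine le_of_mul_le_mul_left ?_ h0
  rw [factorial_mul_mixedVolumeLast hP hL]
  have hi := integrable_mixedHessianDet hP hL
  have hlim : Tendsto (fun R : ℕ => ∫ x in Metric.ball (0 : EuclideanSpace ℝ (Fin (m + 1))) R,
      mixedHessianDet (fun i => (P i).potential) L.potential x) atTop
      (𝓝 (∫ x, mixedHessianDet (fun i => (P i).potential) L.potential x)) := by
    have := tendsto_setIntegral_of_monotone (μ := volume)
      (f := mixedHessianDet (fun i => (P i).potential) L.potential)
      (s := fun R : ℕ => Metric.ball (0 : EuclideanSpace ℝ (Fin (m + 1))) R)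
      (fun R => Metric.isOpen_ball.measurableSet)
      (fun R R' hR => Metric.ball_subset_ball (by exact_mod_cast hR)) hi.integrableOn
    rwa [Metric.iUnion_ball_nat, setIntegral_univ] at this
  refine le_of_tendsto' hlim fun R => ?_
  obtain ⟨c, hc⟩ := (isCompact_closedBall (0 : EuclideanSpace ℝ (Fin (m + 1)))
    (R + 2)).exists_bound_of_continuousOn
      (f := fun x => L'.supportFunction x - L.supportFunction x)
      (L'.continuous_supportFunction.sub L.continuous_supportFunction).continuousOn
  have hc0 : 0 ≤ c := (norm_nonneg _).trans (hc 0 (Metric.mem_closedBall_self (by positivity)))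
  obtain ⟨M, hM⟩ := L.exists_lipschitzWith_supportFunction
  obtain ⟨M', hM'⟩ := L'.exists_lipschitzWith_supportFunction
  set w : EuclideanSpace ℝ (Fin (m + 1)) → ℝ :=
    fun x => max (L.supportFunction x) (L'.supportFunction x - c) with hw
  have hM'' : LipschitzWith M' fun x => L'.supportFunction x - c :=
    LipschitzWith.of_dist_le_mul fun x y => by
      rw [dist_sub_right]; exact hM'.dist_le_mul x y
  have hwL : LipschitzWith (max M M') w := hM.max hM''
  have hwc : ConvexOn ℝ Set.univ w :=
    L.convexOn_supportFunction.sup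
      (L'.convexOn_supportFunction.sub (concaveOn_const c convex_univ))
  have hwp : L'.IsPotential (mollify w) := by
    refine isPotential_mollify hwL hwc (C := c) fun x => ?_
    have h1 : w x ≤ L'.supportFunction x := max_le (h x) (by linarith)
    have h2 : L'.supportFunction x - c ≤ w x := le_max_right _ _
    rw [abs_le]
    constructor <;> linarith
  rw [factorial_mul_mixedVolumeLast hP hwp]
  have e : ∀ x ∈ Metric.ball (0 : EuclideanSpace ℝ (Fin (m + 1))) R,
      mixedHessianDet (fun i => (P i).potential) L.potential x =
        mixedHessianDet (fun i => (P i).potential) (mollify w) x := by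
    intro x hx
    have he : L.potential =ᶠ[𝓝 x] mollify w := by
      filter_upwards [Metric.isOpen_ball.mem_nhds hx] with y hy
      refine mollify_congr fun t ht => ?_
      have hmem : y - t ∈ Metric.closedBall (0 : EuclideanSpace ℝ (Fin (m + 1))) (R + 2) := by
        rw [mem_closedBall_zero_iff]
        have := mem_ball_zero_iff.mp hy
        linarith [norm_sub_le y t]
      have h1 := (le_abs_self _).trans (hc _ hmem)
      exact (max_eq_left (by linarith)).symm
    simp only [mixedHessianDet, hessianMatrix_congr he]
  rw [setIntegral_congr_fun Metric.isOpen_ball.measurableSet e]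
  exact setIntegral_le_integral (integrable_mixedHessianDet hP hwp)
    (Eventually.of_forall (mixedHessianDet_nonneg hP hwp))

end ConvexBody

/-! ### Infinitesimal limits of superadditive families of measures -/

section Superadditive

variable {Ω : Type*} [MeasurableSpace Ω]

/-- Countable additivity of the setwise infimum is monotone convergence for the counting measure. -/
theorem MeasureTheory.exists_measure_eq_iInf_of_antitone (μ : ℕ → Measure Ω) (hμ : Antitone μ)
    [IsFiniteMeasure (μ 0)] :
    ∃ S : Measure Ω, ∀ s, MeasurableSet s → S s = ⨅ k, μ k s := by
  refine ⟨Measure.ofMeasurable (fun s _ => ⨅ k, μ k s) (by simp) ?_,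
    fun s hs => Measure.ofMeasurable_apply s hs⟩
  intro f hf hd
  have h1 : ∀ k, μ k (⋃ i, f i) = ∫⁻ i, μ k (f i) ∂Measure.count := fun k => by
    rw [measure_iUnion hd hf, lintegral_count]
  simp_rw [h1]
  rw [← lintegral_iInf (fun _ => measurable_of_countable _) (fun k l hkl i => hμ hkl (f i)),
    lintegral_count]
  rw [← h1]
  exact measure_ne_top _ _

variable {μ : ℝ → FiniteMeasure Ω}

theorem nat_mul_measureReal_le_of_superadditive
    (h : ∀ a b, 0 < a → 0 < b → (μ a : Measure Ω) + μ b ≤ μ (a + b)) {ρ : ℝ} (hρ : 0 < ρ)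
    (s : Set Ω) (N : ℕ) :
    ((N + 1 : ℕ) : ℝ) * (μ ρ : Measure Ω).real s ≤
      (μ ((N + 1 : ℕ) * ρ) : Measure Ω).real s := by
  induction N with
  | zero => simp
  | succ N ih =>
    have h1 := Measure.le_iff'.mp (h ((N + 1 : ℕ) * ρ) ρ (by positivity) hρ) s
    have h2 : (μ ((N + 1 : ℕ) * ρ) : Measure Ω).real s + (μ ρ : Measure Ω).real s ≤
        (μ ((N + 1 : ℕ) * ρ + ρ) : Measure Ω).real s := by
      rw [← measureReal_add_apply]
      exact ENNReal.toReal_mono (measure_ne_top _ _) h1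
    have e : ((N + 1 + 1 : ℕ) : ℝ) * ρ = (N + 1 : ℕ) * ρ + ρ := by push_cast; ring
    rw [e]
    refine le_trans ?_ h2
    push_cast at ih ⊢
    linarith

theorem measureReal_mono_of_superadditive
    (h : ∀ a b, 0 < a → 0 < b → (μ a : Measure Ω) + μ b ≤ μ (a + b)) {ρ r : ℝ} (hρ : 0 < ρ)
    (hr : ρ ≤ r) (s : Set Ω) : (μ ρ : Measure Ω).real s ≤ (μ r : Measure Ω).real s := by
  rcases hr.eq_or_lt with rfl | hr
  · exact le_rfl
  have h1 := Measure.le_iff'.mp (h ρ (r - ρ) hρ (sub_pos.mpr hr)) s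
  rw [add_sub_cancel] at h1
  refine ENNReal.toReal_mono (measure_ne_top _ _) (le_trans ?_ h1)
  rw [Measure.add_apply]
  exact le_self_add

theorem sub_mul_measureReal_le_of_superadditive
    (h : ∀ a b, 0 < a → 0 < b → (μ a : Measure Ω) + μ b ≤ μ (a + b)) {ρ r : ℝ} (hρ : 0 < ρ)
    (hr : ρ < r) (s : Set Ω) :
    (r - ρ) * (μ ρ : Measure Ω).real s ≤ ρ * (μ r : Measure Ω).real s := by
  obtain ⟨N, hN⟩ : ∃ N : ℕ, ⌊r / ρ⌋₊ = N + 1 := by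
    refine Nat.exists_eq_succ_of_ne_zero ?_
    rw [← Nat.pos_iff_ne_zero, Nat.floor_pos, one_le_div hρ]
    exact hr.le
  have h1 : ((N + 1 : ℕ) : ℝ) * ρ ≤ r := by
    rw [← hN, ← le_div_iff₀ hρ]
    exact Nat.floor_le (div_nonneg (hρ.le.trans hr.le) hρ.le)
  have h2 : r - ρ ≤ ((N + 1 : ℕ) : ℝ) * ρ := by
    have := Nat.lt_floor_add_one (r / ρ)
    rw [hN, div_lt_iff₀ hρ] at this
    linarith
  have h3 := nat_mul_measureReal_le_of_superadditive h hρ s N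
  have h4 := measureReal_mono_of_superadditive h (by positivity : 0 < ((N + 1 : ℕ) : ℝ) * ρ) h1 s
  have h5 : 0 ≤ (μ ρ : Measure Ω).real s := measureReal_nonneg
  calc (r - ρ) * (μ ρ : Measure Ω).real s ≤ ((N + 1 : ℕ) : ℝ) * ρ * (μ ρ : Measure Ω).real s :=
        mul_le_mul_of_nonneg_right h2 h5
    _ = ρ * (((N + 1 : ℕ) : ℝ) * (μ ρ : Measure Ω).real s) := by ring
    _ ≤ _ := mul_le_mul_of_nonneg_left (h3.trans h4) hρ.le

/-- If a family of finite measures is superadditive in the parameter `ρ`, then `ρ⁻¹ μ_ρ` converges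
in total variation as `ρ → 0+`: up to a factor tending to `1` it decreases with `ρ`, and its limit
is a measure below every `ρ⁻¹ μ_ρ`. -/
theorem exists_tendsto_of_superadditive [TopologicalSpace Ω] [OpensMeasurableSpace Ω]
    (h : ∀ a b, 0 < a → 0 < b → (μ a : Measure Ω) + μ b ≤ μ (a + b)) :
    ∃ S : FiniteMeasure Ω,
      (∀ s, MeasurableSet s → Tendsto (fun ρ => ρ⁻¹ * (μ ρ : Measure Ω).real s) (𝓝[>] 0)
        (𝓝 ((S : Measure Ω).real s))) ∧
      Tendsto (fun ρ => (ρ⁻¹).toNNReal • μ ρ) (𝓝[>] 0) (𝓝 S) := by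
  set r : ℕ → ℝ := fun k => (1 / 2) ^ k with hr
  have hr0 : ∀ k, 0 < r k := fun k => by positivity
  have hrlim : Tendsto r atTop (𝓝 0) :=
    tendsto_pow_atTop_nhds_zero_of_lt_one (by norm_num) (by norm_num)
  set ν : ℕ → Measure Ω := fun k => ((2 : NNReal) ^ k • μ (r k) : FiniteMeasure Ω) with hν
  have hνreal : ∀ k s, (ν k).real s = (r k)⁻¹ * (μ (r k) : Measure Ω).real s := by
    intro k s
    simp only [hν, hr, FiniteMeasure.toMeasure_smul, measureReal_nnreal_smul_apply]
    simp
  have hanti : Antitone ν := by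
    refine antitone_nat_of_succ_le fun k => ?_
    have h1 := h (r (k + 1)) (r (k + 1)) (hr0 _) (hr0 _)
    have e : r (k + 1) + r (k + 1) = r k := by simp only [hr, pow_succ]; ring
    rw [e] at h1
    refine Measure.le_iff'.mpr fun s => ?_
    have h2 := Measure.le_iff'.mp h1 s
    simp only [hν, FiniteMeasure.toMeasure_smul, Measure.smul_apply]
    rw [Measure.add_apply, ← two_mul] at h2
    rw [ENNReal.smul_def, ENNReal.smul_def, smul_eq_mul, smul_eq_mul, pow_succ,
      ENNReal.coe_mul, mul_assoc]
    exact mul_le_mul_right h2 _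
  obtain ⟨S, hS⟩ := exists_measure_eq_iInf_of_antitone ν hanti
  have hSle : ∀ k s, MeasurableSet s → S s ≤ ν k s := fun k s hs => by
    rw [hS s hs]; exact iInf_le _ k
  have hSfin : IsFiniteMeasure S :=
    ⟨(hSle 0 _ MeasurableSet.univ).trans_lt (measure_lt_top _ _)⟩
  have hlow : ∀ s, MeasurableSet s → ∀ ρ, 0 < ρ → S.real s ≤ ρ⁻¹ * (μ ρ : Measure Ω).real s := by
    intro s hs ρ hρ
    have hlim : Tendsto (fun k => (ρ - r k)⁻¹ * (μ ρ : Measure Ω).real s) atTop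
        (𝓝 ((ρ - 0)⁻¹ * (μ ρ : Measure Ω).real s)) :=
      ((tendsto_const_nhds.sub hrlim).inv₀ (by simpa using hρ.ne')).mul_const _
    rw [sub_zero] at hlim
    refine ge_of_tendsto hlim ?_
    filter_upwards [hrlim.eventually (gt_mem_nhds hρ)] with k hk
    have h1 := sub_mul_measureReal_le_of_superadditive h (hr0 k) hk s
    have h2 : S.real s ≤ (ν k).real s := ENNReal.toReal_mono (measure_ne_top _ _) (hSle k s hs)
    rw [hνreal] at h2
    refine h2.trans ?_
    have h3 : 0 < ρ - r k := sub_pos.mpr hk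
    rw [inv_mul_le_iff₀ (hr0 k), mul_left_comm, le_inv_mul_iff₀ h3]
    exact h1
  have hset : ∀ s, MeasurableSet s → Tendsto (fun ρ => ρ⁻¹ * (μ ρ : Measure Ω).real s) (𝓝[>] 0)
      (𝓝 (S.real s)) := by
    intro s hs
    rw [tendsto_order]
    refine ⟨fun a ha => ?_, fun b hb => ?_⟩
    · filter_upwards [self_mem_nhdsWithin] with ρ hρ
      exact ha.trans_le (hlow s hs ρ hρ)
    · obtain ⟨k, hk⟩ : ∃ k, (ν k).real s < b := by
        have hb0 : 0 ≤ b := measureReal_nonneg.trans hb.le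
        have h1 : S s < ENNReal.ofReal b :=
          (ENNReal.lt_ofReal_iff_toReal_lt (measure_ne_top _ _)).mpr hb
        rw [hS s hs, iInf_lt_iff] at h1
        obtain ⟨k, hk⟩ := h1
        exact ⟨k, (ENNReal.lt_ofReal_iff_toReal_lt (measure_ne_top _ _)).mp hk⟩
      rw [hνreal] at hk
      have hlim : Tendsto (fun ρ => (r k - ρ)⁻¹ * (μ (r k) : Measure Ω).real s) (𝓝[>] 0)
          (𝓝 ((r k - 0)⁻¹ * (μ (r k) : Measure Ω).real s)) :=
        (((tendsto_const_nhds.sub tendsto_id).inv₀ (by simpa using (hr0 k).ne')).mul_const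
          _).mono_left nhdsWithin_le_nhds
      rw [sub_zero] at hlim
      filter_upwards [hlim.eventually (gt_mem_nhds hk), self_mem_nhdsWithin,
        (gt_mem_nhds (hr0 k) : ∀ᶠ ρ in 𝓝 (0 : ℝ), ρ < r k).filter_mono nhdsWithin_le_nhds]
        with ρ h1 hρ hρk
      refine lt_of_le_of_lt ?_ h1
      have h3 : 0 < r k - ρ := sub_pos.mpr hρk
      rw [inv_mul_le_iff₀ hρ, mul_left_comm, le_inv_mul_iff₀ h3]
      exact sub_mul_measureReal_le_of_superadditive h hρ hρk s
  refine ⟨⟨S, hSfin⟩, hset, FiniteMeasure.tendsto_iff_forall_integral_tendsto.mpr fun f => ?_⟩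
  have hmass := hset _ MeasurableSet.univ
  rw [tendsto_iff_norm_sub_tendsto_zero]
  have hz : Tendsto (fun ρ => ‖f‖ * (ρ⁻¹ * (μ ρ : Measure Ω).real Set.univ - S.real Set.univ))
      (𝓝[>] 0) (𝓝 0) := by
    simpa using (hmass.sub_const (S.real Set.univ)).const_mul ‖f‖
  refine squeeze_zero' (Eventually.of_forall fun _ => norm_nonneg _) ?_ hz
  filter_upwards [self_mem_nhdsWithin] with ρ hρ
  have hρ : 0 < ρ := hρ
  set ν' : FiniteMeasure Ω := (ρ⁻¹).toNNReal • μ ρ with hν'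
  have hreal : ∀ s, (ν' : Measure Ω).real s = ρ⁻¹ * (μ ρ : Measure Ω).real s := by
    intro s
    simp only [hν', FiniteMeasure.toMeasure_smul, measureReal_nnreal_smul_apply]
    rw [Real.coe_toNNReal _ (by positivity)]
  have hle : S ≤ (ν' : Measure Ω) := by
    refine Measure.le_iff.mpr fun s hs => ?_
    rw [← ENNReal.toReal_le_toReal (measure_ne_top _ _) (measure_ne_top _ _)]
    have := hlow s hs ρ hρ
    rw [← hreal] at this
    exact this
  have hsub : (ν' : Measure Ω) = ((ν' : Measure Ω) - S) + S :=
    (Measure.sub_add_cancel_of_le hle).symm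
  have hint : ∫ x, f x ∂(ν' : Measure Ω) = ∫ x, f x ∂((ν' : Measure Ω) - S) + ∫ x, f x ∂S := by
    conv_lhs => rw [hsub]
    exact integral_add_measure (f.integrable _) (f.integrable _)
  have hm : ((ν' : Measure Ω) - S).real Set.univ =
      ρ⁻¹ * (μ ρ : Measure Ω).real Set.univ - S.real Set.univ := by
    rw [← hreal, hsub]
    rw [measureReal_add_apply, Measure.sub_add_cancel_of_le hle]
    ring
  change ‖∫ x, f x ∂(ν' : Measure Ω) - ∫ x, f x ∂S‖ ≤ _
  rw [hint, add_sub_cancel_right, ← hm]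
  exact norm_integral_le_of_norm_le_const (Eventually.of_forall fun x => f.norm_coe_le_norm x)

end Superadditive

/-! ### The metric projection and local parallel sets -/

section Expanding

/-- The inverse of such a map is `1`-Lipschitz, and the volume is a multiple of the Hausdorff
measure. -/
theorem volume_le_volume_image_of_dist_le {n : ℕ} {s : Set (EuclideanSpace ℝ (Fin n))}
    {φ : EuclideanSpace ℝ (Fin n) → EuclideanSpace ℝ (Fin n)}
    (h : ∀ x ∈ s, ∀ y ∈ s, dist x y ≤ dist (φ x) (φ y)) : volume s ≤ volume (φ '' s) := by
  set ψ := Function.invFunOn φ s with hψ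
  have hinj : Set.InjOn φ s := by
    intro x hx y hy hxy
    have := h x hx y hy
    rw [hxy, dist_self] at this
    exact dist_le_zero.mp this
  have hleft : ∀ x ∈ s, ψ (φ x) = x := fun x hx => hinj.leftInvOn_invFunOn hx
  have hlip : LipschitzOnWith 1 ψ (φ '' s) := by
    refine LipschitzOnWith.of_dist_le_mul ?_
    rintro _ ⟨x, hx, rfl⟩ _ ⟨y, hy, rfl⟩
    rw [hleft x hx, hleft y hy, NNReal.coe_one, one_mul]
    exact h x hx y hy
  have himg : ψ '' (φ '' s) = s := by
    ext x
    constructor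
    · rintro ⟨_, ⟨y, hy, rfl⟩, rfl⟩
      rwa [hleft y hy]
    · intro hx
      exact ⟨φ x, ⟨x, hx, rfl⟩, hleft x hx⟩
  have hc := Measure.isAddLeftInvariant_eq_smul
    (volume : Measure (EuclideanSpace ℝ (Fin n)))
    (Measure.hausdorffMeasure (Module.finrank ℝ (EuclideanSpace ℝ (Fin n))))
  have hH := hlip.hausdorffMeasure_image_le
    (d := Module.finrank ℝ (EuclideanSpace ℝ (Fin n))) (by positivity)
  rw [himg] at hH
  simp only [ENNReal.coe_one, ENNReal.one_rpow, one_mul] at hH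
  rw [hc, Measure.smul_apply, Measure.smul_apply]
  rw [ENNReal.smul_def, ENNReal.smul_def]
  exact mul_le_mul_right hH _

end Expanding

namespace ConvexBody

variable {n : ℕ} (K : ConvexBody (EuclideanSpace ℝ (Fin n)))

theorem nearestPoint_mem (x : EuclideanSpace ℝ (Fin n)) : K.nearestPoint x ∈ K :=
  (K.isCompact.exists_infDist_eq_dist K.nonempty x).choose_spec.1

theorem infDist_eq_norm_sub_nearestPoint (x : EuclideanSpace ℝ (Fin n)) :
    Metric.infDist x (K : Set (EuclideanSpace ℝ (Fin n))) = ‖x - K.nearestPoint x‖ := by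
  rw [← dist_eq_norm]
  exact (K.isCompact.exists_infDist_eq_dist K.nonempty x).choose_spec.2

theorem inner_sub_nearestPoint_le (x : EuclideanSpace ℝ (Fin n)) {y : EuclideanSpace ℝ (Fin n)}
    (hy : y ∈ K) : inner ℝ (x - K.nearestPoint x) (y - K.nearestPoint x) ≤ 0 := by
  refine (norm_eq_iInf_iff_real_inner_le_zero K.convex (K.nearestPoint_mem x)).mp ?_ y hy
  rw [← K.infDist_eq_norm_sub_nearestPoint, Metric.infDist_eq_iInf]
  simp_rw [dist_eq_norm]

theorem nearestPoint_eq_of_inner_le {x p : EuclideanSpace ℝ (Fin n)} (hp : p ∈ K)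
    (h : ∀ y ∈ K, inner ℝ (x - p) (y - p) ≤ 0) : K.nearestPoint x = p := by
  have h1 := h _ (K.nearestPoint_mem x)
  have h2 := K.inner_sub_nearestPoint_le x hp
  set q := K.nearestPoint x
  have h3 : inner ℝ (q - p) (q - p) = inner ℝ (x - p) (q - p) + inner ℝ (x - q) (p - q) := by
    rw [show p - q = -(q - p) by abel, inner_neg_right, ← sub_eq_add_neg, ← inner_sub_left]
    congr 1
    abel
  have h4 : inner ℝ (q - p) (q - p) ≤ 0 := by rw [h3]; linarith
  exact sub_eq_zero.mp (real_inner_self_nonpos.mp h4)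

theorem continuous_nearestPoint : Continuous K.nearestPoint := by
  refine (LipschitzWith.of_dist_le_mul (K := 1) fun x y => ?_).continuous
  have h1 := K.inner_sub_nearestPoint_le x (K.nearestPoint_mem y)
  have h2 := K.inner_sub_nearestPoint_le y (K.nearestPoint_mem x)
  set p := K.nearestPoint x
  set q := K.nearestPoint y
  have h3 : inner ℝ (p - q) (p - q) ≤ inner ℝ (x - y) (p - q) := by
    have e : inner ℝ (x - y) (p - q) - inner ℝ (p - q) (p - q) =
        -(inner ℝ (x - p) (q - p)) - inner ℝ (y - q) (p - q) := by
      rw [show q - p = -(p - q) by abel, inner_neg_right, neg_neg, ← inner_sub_left,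
        ← inner_sub_left]
      congr 1
      abel
    linarith
  rw [NNReal.coe_one, one_mul, dist_eq_norm, dist_eq_norm]
  rw [real_inner_self_eq_norm_sq] at h3
  have h4 := h3.trans (real_inner_le_norm _ _)
  rcases (norm_nonneg (p - q)).eq_or_lt with h0 | h0
  · rw [← h0]; exact norm_nonneg _
  · rw [sq] at h4
    exact le_of_mul_le_mul_right h4 h0

theorem measurable_outerNormal : Measurable K.outerNormal := by
  have h1 : Measurable fun x => Metric.infDist x (K : Set (EuclideanSpace ℝ (Fin n))) :=
    (Metric.continuous_infDist_pt _).measurable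
  exact h1.inv.smul (measurable_id.sub K.continuous_nearestPoint.measurable)

variable {K} {x y : EuclideanSpace ℝ (Fin n)}

theorem nearestPoint_add_smul_outerNormal
    (hx : 0 < Metric.infDist x (K : Set (EuclideanSpace ℝ (Fin n)))) :
    x = K.nearestPoint x +
      Metric.infDist x (K : Set (EuclideanSpace ℝ (Fin n))) • K.outerNormal x := by
  rw [outerNormal, smul_smul, mul_inv_cancel₀ hx.ne', one_smul, add_sub_cancel]

theorem norm_outerNormal
    (hx : 0 < Metric.infDist x (K : Set (EuclideanSpace ℝ (Fin n)))) : ‖K.outerNormal x‖ = 1 := by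
  rw [outerNormal, norm_smul, norm_inv, Real.norm_of_nonneg hx.le,
    ← infDist_eq_norm_sub_nearestPoint, inv_mul_cancel₀ hx.ne']

/-- The nearest point lies in the supporting hyperplane with the outer normal direction. -/
theorem inner_nearestPoint_outerNormal
    (hx : 0 < Metric.infDist x (K : Set (EuclideanSpace ℝ (Fin n)))) :
    inner ℝ (K.nearestPoint x) (K.outerNormal x) = K.supportFunction (K.outerNormal x) := by
  refine le_antisymm (inner_le_supportFunction (K.nearestPoint_mem x) _)
    (supportFunction_le fun y hy => ?_)
  have h := K.inner_sub_nearestPoint_le x hy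
  have h2 : inner ℝ (K.outerNormal x) (y - K.nearestPoint x) ≤ 0 := by
    rw [outerNormal, inner_smul_left, conj_trivial]
    exact mul_nonpos_of_nonneg_of_nonpos (inv_nonneg.mpr hx.le) h
  rw [inner_sub_right, real_inner_comm, real_inner_comm (K.nearestPoint x)] at h2
  linarith

theorem inner_outerNormal
    (hx : 0 < Metric.infDist x (K : Set (EuclideanSpace ℝ (Fin n)))) :
    inner ℝ x (K.outerNormal x) = K.supportFunction (K.outerNormal x) +
      Metric.infDist x (K : Set (EuclideanSpace ℝ (Fin n))) := by
  rw [show inner ℝ x (K.outerNormal x) = inner ℝ (K.nearestPoint x + Metric.infDist x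
    (K : Set (EuclideanSpace ℝ (Fin n))) • K.outerNormal x) (K.outerNormal x) from
      congrArg (fun z => inner ℝ z (K.outerNormal x)) (nearestPoint_add_smul_outerNormal hx)]
  rw [inner_add_left, inner_smul_left, conj_trivial, inner_nearestPoint_outerNormal hx,
    real_inner_self_eq_norm_sq, norm_outerNormal hx]
  ring

/-- Moving a point outwards along its normal ray does not change its nearest point. -/
theorem nearestPoint_push
    (hx : 0 < Metric.infDist x (K : Set (EuclideanSpace ℝ (Fin n)))) {a : ℝ} (ha : 0 ≤ a) :
    K.nearestPoint (x + a • K.outerNormal x) = K.nearestPoint x := by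
  refine K.nearestPoint_eq_of_inner_le (K.nearestPoint_mem x) fun y hy => ?_
  set d := Metric.infDist x (K : Set (EuclideanSpace ℝ (Fin n))) with hd
  have e : x + a • K.outerNormal x - K.nearestPoint x =
      (1 + a * d⁻¹) • (x - K.nearestPoint x) := by
    rw [outerNormal, ← hd, smul_smul, add_smul, one_smul]
    abel
  rw [e, inner_smul_left, conj_trivial]
  exact mul_nonpos_of_nonneg_of_nonpos (by positivity) (K.inner_sub_nearestPoint_le x hy)

theorem infDist_push
    (hx : 0 < Metric.infDist x (K : Set (EuclideanSpace ℝ (Fin n)))) {a : ℝ} (ha : 0 ≤ a) :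
    Metric.infDist (x + a • K.outerNormal x) (K : Set (EuclideanSpace ℝ (Fin n))) =
      Metric.infDist x (K : Set (EuclideanSpace ℝ (Fin n))) + a := by
  rw [infDist_eq_norm_sub_nearestPoint, nearestPoint_push hx ha]
  set d := Metric.infDist x (K : Set (EuclideanSpace ℝ (Fin n))) with hd
  have e : x + a • K.outerNormal x - K.nearestPoint x = (d + a) • K.outerNormal x := by
    have := nearestPoint_add_smul_outerNormal hx
    rw [← hd] at this
    nth_rewrite 1 [this]
    rw [add_smul]
    abel
  rw [e, norm_smul, norm_outerNormal hx, mul_one, Real.norm_of_nonneg (by positivity)]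

theorem outerNormal_push
    (hx : 0 < Metric.infDist x (K : Set (EuclideanSpace ℝ (Fin n)))) {a : ℝ} (ha : 0 ≤ a) :
    K.outerNormal (x + a • K.outerNormal x) = K.outerNormal x := by
  set d := Metric.infDist x (K : Set (EuclideanSpace ℝ (Fin n))) with hd
  have e : x + a • K.outerNormal x - K.nearestPoint x = (d + a) • K.outerNormal x := by
    have := nearestPoint_add_smul_outerNormal hx
    rw [← hd] at this
    nth_rewrite 1 [this]
    rw [add_smul]
    abel
  have h0 : d + a ≠ 0 := by positivity
  conv_lhs => rw [outerNormal, infDist_push hx ha, nearestPoint_push hx ha, e]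
  rw [smul_smul, inv_mul_cancel₀ h0, one_smul]

/-- Moving points outwards along their normal rays does not decrease distances, since the normal
field of a convex body is monotone. -/
theorem dist_le_dist_push
    (hx : 0 < Metric.infDist x (K : Set (EuclideanSpace ℝ (Fin n))))
    (hy : 0 < Metric.infDist y (K : Set (EuclideanSpace ℝ (Fin n)))) {a : ℝ} (ha : 0 ≤ a) :
    dist x y ≤ dist (x + a • K.outerNormal x) (y + a • K.outerNormal y) := by
  have hmono : 0 ≤ inner ℝ (x - y) (K.outerNormal x - K.outerNormal y) := by
    have h1 := inner_outerNormal hx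
    have h2 := inner_outerNormal hy
    have h3 : inner ℝ x (K.outerNormal y) ≤ K.supportFunction (K.outerNormal y) +
        Metric.infDist x (K : Set (EuclideanSpace ℝ (Fin n))) := by
      conv_lhs => rw [nearestPoint_add_smul_outerNormal hx]
      rw [inner_add_left, inner_smul_left, conj_trivial]
      refine add_le_add (inner_le_supportFunction (K.nearestPoint_mem x) _) ?_
      have := real_inner_le_norm (K.outerNormal x) (K.outerNormal y)
      rw [norm_outerNormal hx, norm_outerNormal hy, one_mul] at this
      exact (mul_le_mul_of_nonneg_left this hx.le).trans_eq (mul_one _)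
    have h4 : inner ℝ y (K.outerNormal x) ≤ K.supportFunction (K.outerNormal x) +
        Metric.infDist y (K : Set (EuclideanSpace ℝ (Fin n))) := by
      conv_lhs => rw [nearestPoint_add_smul_outerNormal hy]
      rw [inner_add_left, inner_smul_left, conj_trivial]
      refine add_le_add (inner_le_supportFunction (K.nearestPoint_mem y) _) ?_
      have := real_inner_le_norm (K.outerNormal y) (K.outerNormal x)
      rw [norm_outerNormal hx, norm_outerNormal hy, one_mul] at this
      exact (mul_le_mul_of_nonneg_left this hy.le).trans_eq (mul_one _)
    rw [inner_sub_left, inner_sub_right, inner_sub_right]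
    linarith
  rw [dist_eq_norm, dist_eq_norm,
    show x + a • K.outerNormal x - (y + a • K.outerNormal y) =
      (x - y) + a • (K.outerNormal x - K.outerNormal y) by rw [smul_sub]; abel]
  refine le_of_sq_le_sq ?_ (norm_nonneg _)
  rw [norm_add_sq_real, inner_smul_right]
  have := mul_nonneg ha hmono
  have := sq_nonneg ‖a • (K.outerNormal x - K.outerNormal y)‖
  linarith

/-! ### Existence of the surface area measure -/

theorem measurableSet_shell (K : ConvexBody (EuclideanSpace ℝ (Fin n))) (ρ : ℝ) :
    MeasurableSet (K.shell ρ) := by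
  have h1 : Measurable fun x => Metric.infDist x (K : Set (EuclideanSpace ℝ (Fin n))) :=
    (Metric.continuous_infDist_pt _).measurable
  exact (measurableSet_lt measurable_const h1).inter (measurableSet_le h1 measurable_const)

theorem localParallelVolume_apply (K : ConvexBody (EuclideanSpace ℝ (Fin n))) (ρ : ℝ)
    {s : Set (UnitSphere n)} (hs : MeasurableSet s) :
    (K.localParallelVolume ρ : Measure (UnitSphere n)) s =
      volume (K.shell ρ ∩ K.outerNormal ⁻¹' (Subtype.val '' s)) := by
  have hsph : MeasurableSet (Metric.sphere (0 : EuclideanSpace ℝ (Fin n)) 1) :=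
    Metric.isClosed_sphere.measurableSet
  change ((volume.restrict (K.shell ρ)).map K.outerNormal).comap Subtype.val s = _
  rw [comap_subtype_coe_apply hsph, Measure.map_apply K.measurable_outerNormal
    (hsph.subtype_image hs), Measure.restrict_apply
    (K.measurable_outerNormal (hsph.subtype_image hs)), Set.inter_comm]

theorem localParallelVolume_superadditive (K : ConvexBody (EuclideanSpace ℝ (Fin n))) (a b : ℝ)
    (ha : 0 < a) (hb : 0 < b) :
    (K.localParallelVolume a : Measure (UnitSphere n)) + K.localParallelVolume b ≤
      K.localParallelVolume (a + b) := by
  refine Measure.le_iff.mpr fun s hs => ?_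
  rw [Measure.add_apply, localParallelVolume_apply K _ hs, localParallelVolume_apply K _ hs,
    localParallelVolume_apply K _ hs]
  have hsph : MeasurableSet (Metric.sphere (0 : EuclideanSpace ℝ (Fin n)) 1) :=
    Metric.isClosed_sphere.measurableSet
  set A := K.shell a ∩ K.outerNormal ⁻¹' (Subtype.val '' s) with hA
  set B := K.shell b ∩ K.outerNormal ⁻¹' (Subtype.val '' s) with hB
  have hAm : MeasurableSet A :=
    (K.measurableSet_shell a).inter (K.measurable_outerNormal (hsph.subtype_image hs))
  have h1 : volume B ≤ volume ((fun x => x + a • K.outerNormal x) '' B) :=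
    volume_le_volume_image_of_dist_le fun x hx y hy => dist_le_dist_push hx.1.1 hy.1.1 ha.le
  have hdisj : Disjoint A ((fun x => x + a • K.outerNormal x) '' B) := by
    rw [Set.disjoint_left]
    rintro _ hxA ⟨x, hx, rfl⟩
    have h2 := hxA.1.2
    simp only at h2
    rw [infDist_push hx.1.1 ha.le] at h2
    have := hx.1.1
    linarith
  calc volume A + volume B ≤ volume A + volume ((fun x => x + a • K.outerNormal x) '' B) := by
        gcongr
    _ = volume (A ∪ (fun x => x + a • K.outerNormal x) '' B) :=
        (measure_union' hdisj hAm).symm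
    _ ≤ _ := by
        refine measure_mono (Set.union_subset ?_ ?_)
        · intro x hx
          exact ⟨⟨hx.1.1, hx.1.2.trans (by linarith)⟩, hx.2⟩
        · rintro _ ⟨x, hx, rfl⟩
          refine ⟨⟨?_, ?_⟩, ?_⟩
          · rw [infDist_push hx.1.1 ha.le]
            have := hx.1.1
            linarith
          · rw [infDist_push hx.1.1 ha.le]
            have := hx.1.2
            linarith
          · simp only [Set.mem_preimage]
            rw [outerNormal_push hx.1.1 ha.le]
            exact hx.2

/-- The limit defining the surface area measure also exists setwise. -/
theorem tendsto_localParallelVolume_apply (K : ConvexBody (EuclideanSpace ℝ (Fin n)))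
    {s : Set (UnitSphere n)} (hs : MeasurableSet s) :
    Tendsto (fun ρ => ρ⁻¹ * (K.localParallelVolume ρ : Measure (UnitSphere n)).real s) (𝓝[>] 0)
      (𝓝 ((K.surfaceAreaMeasure : Measure (UnitSphere n)).real s)) := by
  obtain ⟨S, h1, h2⟩ := exists_tendsto_of_superadditive K.localParallelVolume_superadditive
  have e : K.surfaceAreaMeasure = S := h2.limUnder_eq
  rw [e]
  exact h1 s hs

end ConvexBody

/-! ### Surface area measures and first variations of volume -/

namespace ConvexBody

/-- The closed unit ball as a convex body. -/
def unitBall (n : ℕ) : ConvexBody (EuclideanSpace ℝ (Fin n)) :=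
  ⟨Metric.closedBall 0 1, convex_closedBall 0 1, isCompact_closedBall 0 1,
    ⟨0, Metric.mem_closedBall_self zero_le_one⟩⟩

theorem mem_unitBall {n : ℕ} {x : EuclideanSpace ℝ (Fin n)} : x ∈ unitBall n ↔ ‖x‖ ≤ 1 :=
  mem_closedBall_zero_iff

theorem supportFunction_unitBall {n : ℕ} (u : EuclideanSpace ℝ (Fin n)) :
    (unitBall n).supportFunction u = ‖u‖ := by
  apply le_antisymm
  · refine supportFunction_le fun x hx => (real_inner_le_norm _ _).trans ?_
    exact mul_le_of_le_one_left (norm_nonneg _) (mem_unitBall.mp hx)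
  · rcases eq_or_ne u 0 with rfl | hu
    · have := inner_le_supportFunction (K := unitBall n)
        (mem_unitBall.mpr (by simp : ‖(0 : EuclideanSpace ℝ (Fin n))‖ ≤ 1)) 0
      simpa using this
    · have h0 : ‖u‖ ≠ 0 := norm_ne_zero_iff.mpr hu
      have := inner_le_supportFunction (K := unitBall n) (x := ‖u‖⁻¹ • u)
        (mem_unitBall.mpr (by rw [norm_smul, norm_inv, norm_norm, inv_mul_cancel₀ h0])) u
      rw [inner_smul_left, conj_trivial, real_inner_self_eq_norm_sq, sq, ← mul_assoc,
        inv_mul_cancel₀ h0, one_mul] at this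
      exact this

/-- By positive homogeneity, support functions can be compared on the unit sphere. -/
theorem supportFunction_le_of_forall_unitSphere {n : ℕ}
    {K L : ConvexBody (EuclideanSpace ℝ (Fin n))}
    (h : ∀ u : UnitSphere n, K.supportFunction u ≤ L.supportFunction u)
    (u : EuclideanSpace ℝ (Fin n)) : K.supportFunction u ≤ L.supportFunction u := by
  rcases eq_or_ne u 0 with rfl | hu
  · have hK := K.supportFunction_smul le_rfl (0 : EuclideanSpace ℝ (Fin n))
    have hL := L.supportFunction_smul le_rfl (0 : EuclideanSpace ℝ (Fin n))
    rw [zero_smul, zero_mul] at hK hL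
    rw [hK, hL]
  · have h0 : ‖u‖ ≠ 0 := norm_ne_zero_iff.mpr hu
    have e : u = ‖u‖ • (‖u‖⁻¹ • u) := by rw [smul_smul, mul_inv_cancel₀ h0, one_smul]
    have hs : ‖u‖⁻¹ • u ∈ Metric.sphere (0 : EuclideanSpace ℝ (Fin n)) 1 := by
      rw [mem_sphere_zero_iff_norm, norm_smul, norm_inv, norm_norm, inv_mul_cancel₀ h0]
    rw [e, supportFunction_smul _ (norm_nonneg u), supportFunction_smul _ (norm_nonneg u)]
    exact mul_le_mul_of_nonneg_left (h ⟨_, hs⟩) (norm_nonneg u)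

theorem integrable_supportFunction {n : ℕ} (L : ConvexBody (EuclideanSpace ℝ (Fin n)))
    (S : Measure (UnitSphere n)) [IsFiniteMeasure S] :
    Integrable (fun u : UnitSphere n => L.supportFunction u) S :=
  (L.continuous_supportFunction.comp continuous_subtype_val).integrable_of_hasCompactSupport
    (HasCompactSupport.of_compactSpace _)

/-- A Minkowski sum `K + ρ L` is contained in the region swept out by moving the boundary points of
`K` by `ρ h_L(u)` in the direction of their outer normals `u`. -/
theorem infDist_le_of_mem_add_smul {n : ℕ} {K L : ConvexBody (EuclideanSpace ℝ (Fin n))} {ρ : ℝ}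
    (hρ : 0 ≤ ρ) {x : EuclideanSpace ℝ (Fin n)} (hx : x ∈ K + ρ • L)
    (hd : 0 < Metric.infDist x (K : Set (EuclideanSpace ℝ (Fin n)))) :
    Metric.infDist x (K : Set (EuclideanSpace ℝ (Fin n))) ≤
      ρ * L.supportFunction (K.outerNormal x) := by
  have h := inner_le_supportFunction hx (K.outerNormal x)
  rw [inner_outerNormal hd, supportFunction_add_body, supportFunction_smul_body _ hρ] at h
  linarith

variable {m : ℕ}

/-- The volume of `K + ρ L` is bounded by local parallel volumes of `K`, after cutting the sphere
into the pieces where `h_L / ε` rounds up to a given integer. -/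
theorem volume_add_smul_le_sum {n : ℕ} (K L : ConvexBody (EuclideanSpace ℝ (Fin n)))
    {ε : ℝ} (hε : 0 < ε) {N : ℕ}
    (hN : ∀ u : UnitSphere n, ⌈L.supportFunction u / ε⌉₊ ≤ N) {ρ : ℝ} (hρ : 0 < ρ) :
    volume.real ((K + ρ • L : ConvexBody _) : Set (EuclideanSpace ℝ (Fin n))) ≤
      volume.real (K : Set (EuclideanSpace ℝ (Fin n))) +
        ∑ i ∈ Finset.range (N + 1), (K.localParallelVolume (ε * i * ρ) :
          Measure (UnitSphere n)).real {u | ⌈L.supportFunction u / ε⌉₊ = i} := by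
  set ω : ℕ → Set (UnitSphere n) := fun i => {u | ⌈L.supportFunction u / ε⌉₊ = i} with hω
  have hωm : ∀ i, MeasurableSet (ω i) := by
    intro i
    have h1 : Measurable fun u : UnitSphere n => ⌈L.supportFunction u / ε⌉₊ :=
      Nat.measurable_ceil.comp
        ((L.continuous_supportFunction.measurable.comp measurable_subtype_coe).div_const ε)
    exact h1 (measurableSet_singleton i)
  set A : ℕ → Set (EuclideanSpace ℝ (Fin n)) := fun i =>
    K.shell (ε * i * ρ) ∩ K.outerNormal ⁻¹' (Subtype.val '' ω i) with hA
  have hAreal : ∀ i : ℕ, (K.localParallelVolume (ε * i * ρ) : Measure (UnitSphere n)).real (ω i) =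
      volume.real (A i) := fun i => by
    rw [Measure.real, localParallelVolume_apply K _ (hωm i)]; rfl
  have hAfin : ∀ i, volume (A i) ≠ ⊤ := fun i =>
    ((measure_mono Set.inter_subset_left).trans_lt (K.volume_shell_lt_top _)).ne
  have hsub : ((K + ρ • L : ConvexBody _) : Set (EuclideanSpace ℝ (Fin n))) ⊆
      (K : Set (EuclideanSpace ℝ (Fin n))) ∪ ⋃ i ∈ Finset.range (N + 1), A i := by
    intro x hx
    by_cases hxK : x ∈ (K : Set (EuclideanSpace ℝ (Fin n)))
    · exact Or.inl hxK
    right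
    have hd : 0 < Metric.infDist x (K : Set (EuclideanSpace ℝ (Fin n))) :=
      (K.isClosed.notMem_iff_infDist_pos K.nonempty).mp hxK
    have hs : K.outerNormal x ∈ Metric.sphere (0 : EuclideanSpace ℝ (Fin n)) 1 :=
      mem_sphere_zero_iff_norm.mpr (norm_outerNormal hd)
    set i := ⌈L.supportFunction (K.outerNormal x) / ε⌉₊ with hi
    have h1 := infDist_le_of_mem_add_smul hρ.le hx hd
    have h2 : L.supportFunction (K.outerNormal x) ≤ ε * i := by
      rw [← div_le_iff₀' hε]
      exact Nat.le_ceil _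
    refine Set.mem_biUnion (x := i) ?_ ⟨⟨hd, ?_⟩, ⟨⟨_, hs⟩, rfl, rfl⟩⟩
    · exact Finset.mem_coe.mpr (Finset.mem_range.mpr (Nat.lt_succ_of_le (hN ⟨_, hs⟩)))
    · refine h1.trans ?_
      rw [mul_comm]
      exact mul_le_mul_of_nonneg_right h2 hρ.le
  rw [Finset.sum_congr rfl fun i _ => hAreal i]
  have hUfin : volume (⋃ i ∈ Finset.range (N + 1), A i) ≠ ⊤ :=
    ((measure_biUnion_finset_le _ _).trans_lt
      (ENNReal.sum_lt_top.mpr fun i _ => (hAfin i).lt_top)).ne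
  refine (measureReal_mono hsub
    (measure_union_ne_top K.isCompact.measure_lt_top.ne hUfin)).trans ?_
  refine (measureReal_union_le _ _).trans (add_le_add le_rfl ?_)
  exact measureReal_biUnion_finset_le _ _

theorem tendsto_localParallelVolume_mul {n : ℕ} (K : ConvexBody (EuclideanSpace ℝ (Fin n)))
    {s : Set (UnitSphere n)} (hs : MeasurableSet s) {c : ℝ} (hc : 0 ≤ c) :
    Tendsto (fun ρ => ρ⁻¹ * (K.localParallelVolume (c * ρ) : Measure (UnitSphere n)).real s)
      (𝓝[>] 0) (𝓝 (c * (K.surfaceAreaMeasure : Measure (UnitSphere n)).real s)) := by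
  rcases hc.eq_or_lt with rfl | hc
  -- the shell of radius `0` is empty
  · have h0 : (K.localParallelVolume 0 : Measure (UnitSphere n)).real s = 0 := by
      have : K.shell 0 = ∅ := by
        ext x
        simp only [shell, Set.mem_ofPred_eq, Set.mem_empty_iff_false, iff_false, not_and, not_le]
        exact id
      rw [Measure.real, localParallelVolume_apply K _ hs, this]
      simp
    simp [h0]
  · have h1 : Tendsto (fun ρ : ℝ => c * ρ) (𝓝[>] 0) (𝓝[>] 0) := by
      refine tendsto_nhdsWithin_iff.mpr ⟨?_, ?_⟩
      · have : Tendsto (fun ρ : ℝ => c * ρ) (𝓝 0) (𝓝 (c * 0)) := tendsto_id.const_mul c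
        rw [mul_zero] at this
        exact this.mono_left nhdsWithin_le_nhds
      · filter_upwards [self_mem_nhdsWithin] with ρ hρ
        exact mul_pos hc hρ
    refine (((K.tendsto_localParallelVolume_apply hs).comp h1).const_mul c).congr fun ρ => ?_
    simp only [Function.comp, mul_inv]
    field_simp

/-- The first variation of volume in the direction of `L` is at most the integral of the support
function of `L` against the surface area measure. -/
theorem mul_mixedVolumeLast_le_integral (K L : ConvexBody (EuclideanSpace ℝ (Fin (m + 1))))
    (hL : ∀ u : UnitSphere (m + 1), 0 ≤ L.supportFunction u) :
    (m + 1 : ℕ) * mixedVolumeLast (fun _ : Fin m => K) L ≤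
      ∫ u : UnitSphere (m + 1), L.supportFunction u ∂(K.surfaceAreaMeasure : Measure _) := by
  set S := (K.surfaceAreaMeasure : Measure (UnitSphere (m + 1))) with hS
  have hcont : Continuous fun u : UnitSphere (m + 1) => L.supportFunction u :=
    L.continuous_supportFunction.comp continuous_subtype_val
  have hint := L.integrable_supportFunction S
  have key : ∀ ε : ℝ, 0 < ε → (m + 1 : ℕ) * mixedVolumeLast (fun _ : Fin m => K) L ≤
      ∫ u : UnitSphere (m + 1), L.supportFunction u ∂S + ε * S.real Set.univ := by
    intro ε hε
    obtain ⟨M, hM⟩ := isCompact_univ.exists_bound_of_continuousOn hcont.continuousOn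
    set N := ⌈M / ε⌉₊
    have hN : ∀ u : UnitSphere (m + 1), ⌈L.supportFunction u / ε⌉₊ ≤ N := fun u =>
      Nat.ceil_mono (div_le_div_of_nonneg_right ((le_abs_self _).trans (hM u (Set.mem_univ u)))
        hε.le)
    set ω : ℕ → Set (UnitSphere (m + 1)) :=
      fun i => {u | ⌈L.supportFunction u / ε⌉₊ = i} with hω
    have hωm : ∀ i, MeasurableSet (ω i) := by
      intro i
      have h1 : Measurable fun u : UnitSphere (m + 1) => ⌈L.supportFunction u / ε⌉₊ :=
        Nat.measurable_ceil.comp (hcont.measurable.div_const ε)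
      exact h1 (measurableSet_singleton i)
    have hlim : Tendsto (fun ρ => ∑ i ∈ Finset.range (N + 1), ρ⁻¹ *
        (K.localParallelVolume (ε * i * ρ) : Measure (UnitSphere (m + 1))).real (ω i)) (𝓝[>] 0)
        (𝓝 (∑ i ∈ Finset.range (N + 1), ε * i * S.real (ω i))) :=
      tendsto_finsetSum _ fun i _ =>
        K.tendsto_localParallelVolume_mul (hωm i) (mul_nonneg hε.le (Nat.cast_nonneg i))
    have h1 : (m + 1 : ℕ) * mixedVolumeLast (fun _ : Fin m => K) L ≤
        ∑ i ∈ Finset.range (N + 1), ε * i * S.real (ω i) := by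
      refine ge_of_tendsto hlim ?_
      filter_upwards [self_mem_nhdsWithin,
        (gt_mem_nhds one_pos : ∀ᶠ ρ in 𝓝 (0 : ℝ), ρ < 1).filter_mono nhdsWithin_le_nhds]
        with ρ hρ hρ1
      have hρ : 0 < ρ := hρ
      have h2 := (volume_add_smul_bounds K L hρ.le hρ1.le).1
      have h3 := volume_add_smul_le_sum K L hε hN hρ
      rw [← Finset.mul_sum, le_inv_mul_iff₀ hρ]
      linarith
    refine h1.trans ?_
    have hpart : ∀ u : UnitSphere (m + 1), L.supportFunction u + ε =
        ∑ i ∈ Finset.range (N + 1), (ω i).indicator (fun u => L.supportFunction u + ε) u := by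
      intro u
      rw [Finset.sum_eq_single ⌈L.supportFunction u / ε⌉₊]
      · rw [Set.indicator_of_mem (show u ∈ ω _ from rfl)]
      · intro i _ hi
        exact Set.indicator_of_notMem (fun h => hi h.symm) _
      · intro h
        exact absurd (Finset.mem_range.mpr (Nat.lt_succ_of_le (hN u))) h
    have hintε : Integrable (fun u : UnitSphere (m + 1) => L.supportFunction u + ε) S :=
      hint.add (integrable_const ε)
    have h4 : ∫ u : UnitSphere (m + 1), L.supportFunction u ∂S + ε * S.real Set.univ =
        ∫ u : UnitSphere (m + 1), (L.supportFunction u + ε) ∂S := by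
      rw [integral_add hint (integrable_const ε), integral_const, smul_eq_mul, mul_comm ε]
    rw [h4, integral_congr_ae (Eventually.of_forall hpart),
      integral_finsetSum _ fun i _ => hintε.indicator (hωm i)]
    refine Finset.sum_le_sum fun i _ => ?_
    rw [integral_indicator (hωm i)]
    have h5 : ε * i * S.real (ω i) = ∫ _ in ω i, ε * (i : ℝ) ∂S := by
      rw [setIntegral_const, smul_eq_mul, mul_comm]
    rw [h5]
    refine setIntegral_mono_on (integrable_const _).integrableOn hintε.integrableOn (hωm i)
      fun u hu => ?_
    have h6 := (Nat.ceil_lt_add_one (div_nonneg (hL u) hε.le)).le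
    rw [show ⌈L.supportFunction u / ε⌉₊ = i from hu] at h6
    calc ε * (i : ℝ) ≤ ε * (L.supportFunction u / ε + 1) := mul_le_mul_of_nonneg_left h6 hε.le
      _ = L.supportFunction u + ε := by field_simp
  have hlim : Tendsto (fun ε : ℝ => ∫ u : UnitSphere (m + 1), L.supportFunction u ∂S +
      ε * S.real Set.univ) (𝓝[>] 0)
      (𝓝 (∫ u : UnitSphere (m + 1), L.supportFunction u ∂S + 0 * S.real Set.univ)) :=
    ((tendsto_id.mul_const _).const_add _).mono_left nhdsWithin_le_nhds
  rw [zero_mul, add_zero] at hlim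
  refine ge_of_tendsto hlim ?_
  filter_upwards [self_mem_nhdsWithin] with ε hε
  exact key ε hε

theorem surfaceAreaMeasure_univ_le (K : ConvexBody (EuclideanSpace ℝ (Fin (m + 1)))) :
    (K.surfaceAreaMeasure : Measure (UnitSphere (m + 1))).real Set.univ ≤
      (m + 1 : ℕ) * mixedVolumeLast (fun _ : Fin m => K) (unitBall (m + 1)) := by
  set B := unitBall (m + 1)
  set V := volume.real ((K + B : ConvexBody _) : Set (EuclideanSpace ℝ (Fin (m + 1))))
  have hlim : Tendsto (fun ρ : ℝ => (m + 1 : ℕ) * mixedVolumeLast (fun _ : Fin m => K) B + ρ * V)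
      (𝓝[>] 0) (𝓝 ((m + 1 : ℕ) * mixedVolumeLast (fun _ : Fin m => K) B + 0 * V)) :=
    ((tendsto_id.mul_const _).const_add _).mono_left nhdsWithin_le_nhds
  rw [zero_mul, add_zero] at hlim
  refine le_of_tendsto_of_tendsto (K.tendsto_localParallelVolume_apply MeasurableSet.univ) hlim ?_
  filter_upwards [self_mem_nhdsWithin,
    (gt_mem_nhds one_pos : ∀ᶠ ρ in 𝓝 (0 : ℝ), ρ < 1).filter_mono nhdsWithin_le_nhds]
    with ρ hρ hρ1
  have hρ : 0 < ρ := hρ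
  have h1 := (volume_add_smul_bounds K B hρ.le hρ1.le).2
  have h2 : (K.localParallelVolume ρ : Measure (UnitSphere (m + 1))).real Set.univ ≤
      volume.real (K.shell ρ) := by
    rw [Measure.real, localParallelVolume_apply K _ MeasurableSet.univ]
    exact ENNReal.toReal_mono (K.volume_shell_lt_top ρ).ne (measure_mono Set.inter_subset_left)
  have h3 : volume.real (K.shell ρ) + volume.real (K : Set (EuclideanSpace ℝ (Fin (m + 1)))) ≤
      volume.real ((K + ρ • B : ConvexBody _) : Set (EuclideanSpace ℝ (Fin (m + 1)))) := by
    have hdisj : Disjoint (K.shell ρ) (K : Set (EuclideanSpace ℝ (Fin (m + 1)))) := by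
      rw [Set.disjoint_left]
      intro x hx hxK
      have := hx.1
      rw [Metric.infDist_zero_of_mem hxK] at this
      exact lt_irrefl _ this
    rw [← measureReal_union hdisj K.isClosed.measurableSet (K.volume_shell_lt_top ρ).ne
      K.isCompact.measure_lt_top.ne]
    refine measureReal_mono (Set.union_subset ?_ ?_) (K + ρ • B).isCompact.measure_lt_top.ne
    · intro x hx
      rw [coe_add, coe_smul]
      refine ⟨K.nearestPoint x, K.nearestPoint_mem x, x - K.nearestPoint x, ?_, by simp⟩
      refine ⟨ρ⁻¹ • (x - K.nearestPoint x), mem_unitBall.mpr ?_, ?_⟩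
      · rw [norm_smul, norm_inv, Real.norm_of_nonneg hρ.le, ← infDist_eq_norm_sub_nearestPoint,
          inv_mul_le_iff₀ hρ, mul_one]
        exact hx.2
      · simp only [smul_smul]
        rw [mul_inv_cancel₀ hρ.ne', one_smul]
    · intro x hx
      rw [coe_add, coe_smul]
      exact ⟨x, hx, 0, ⟨0, mem_unitBall.mpr (by simp), by simp⟩, by simp⟩
  rw [inv_mul_le_iff₀ hρ]
  nlinarith

/-- Equality in `mul_mixedVolumeLast_le_integral` for summands of balls: both sides are additive in
`L`, and they agree for balls. -/
theorem mul_mixedVolumeLast_eq_integral_of_add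
    (K L L' : ConvexBody (EuclideanSpace ℝ (Fin (m + 1))))
    (hL : ∀ u : UnitSphere (m + 1), 0 ≤ L.supportFunction u)
    (hL' : ∀ u : UnitSphere (m + 1), 0 ≤ L'.supportFunction u) {c : ℝ} (hc : 0 ≤ c)
    (h : ∀ u : UnitSphere (m + 1), L.supportFunction u + L'.supportFunction u = c) :
    (m + 1 : ℕ) * mixedVolumeLast (fun _ : Fin m => K) L =
      ∫ u : UnitSphere (m + 1), L.supportFunction u ∂(K.surfaceAreaMeasure : Measure _) := by
  set S := (K.surfaceAreaMeasure : Measure (UnitSphere (m + 1))) with hS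
  have h1 := mul_mixedVolumeLast_le_integral K L hL
  have h2 := mul_mixedVolumeLast_le_integral K L' hL'
  have h3 : ∫ u : UnitSphere (m + 1), L.supportFunction u ∂S +
      ∫ u : UnitSphere (m + 1), L'.supportFunction u ∂S = c * S.real Set.univ := by
    rw [← integral_add (L.integrable_supportFunction S) (L'.integrable_supportFunction S)]
    simp_rw [h]
    rw [integral_const, smul_eq_mul, mul_comm]
  have h4 : c * mixedVolumeLast (fun _ : Fin m => K) (unitBall (m + 1)) ≤
      mixedVolumeLast (fun _ : Fin m => K) L + mixedVolumeLast (fun _ : Fin m => K) L' := by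
    rw [← mixedVolumeLast_smul _ _ hc, ← mixedVolumeLast_add]
    refine mixedVolumeLast_mono _ (supportFunction_le_of_forall_unitSphere fun u => ?_)
    rw [supportFunction_smul_body _ hc, supportFunction_unitBall, supportFunction_add_body, h u,
      mem_sphere_zero_iff_norm.mp u.2, mul_one]
  have h5 := mul_le_mul_of_nonneg_left K.surfaceAreaMeasure_univ_le hc
  have h6 : (0 : ℝ) ≤ ((m + 1 : ℕ) : ℝ) := Nat.cast_nonneg _
  have h7 := mul_le_mul_of_nonneg_left h4 h6
  rw [← hS] at h1 h2 h5
  refine le_antisymm h1 ?_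
  linarith

end ConvexBody

/-! ### Functions with quadratic expansions are differences of support functions -/

namespace ConvexBody

section QuadraticExpansion

variable {n : ℕ}

/-- A function on the sphere has uniform quadratic expansions if around each point `u` it agrees
with an affine function, of bounded slope, up to an error that is at most a fixed multiple of the
squared distance to `u`. -/
def HasQuadraticExpansions (f : C(UnitSphere n, ℝ)) : Prop :=
  ∃ (g : UnitSphere n → EuclideanSpace ℝ (Fin n)) (C M : ℝ), 0 ≤ C ∧ ∀ u, ‖g u‖ ≤ M ∧
    ∀ x : UnitSphere n, |f x - f u - inner ℝ (g u) ((x : EuclideanSpace ℝ (Fin n)) - u)| ≤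
      C * ‖(x : EuclideanSpace ℝ (Fin n)) - u‖ ^ 2

theorem hasQuadraticExpansions_const (c : ℝ) :
    HasQuadraticExpansions (algebraMap ℝ C(UnitSphere n, ℝ) c) :=
  ⟨0, 0, 0, le_rfl, fun u => ⟨by simp, fun x => by simp⟩⟩

theorem hasQuadraticExpansions_inner (v : EuclideanSpace ℝ (Fin n)) :
    HasQuadraticExpansions (⟨fun x : UnitSphere n => inner ℝ v x, by fun_prop⟩ :
      C(UnitSphere n, ℝ)) :=
  ⟨fun _ => v, 0, ‖v‖, le_rfl, fun u => ⟨le_rfl, fun x => by simp [inner_sub_right]⟩⟩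

theorem HasQuadraticExpansions.add {f₁ f₂ : C(UnitSphere n, ℝ)} (h₁ : HasQuadraticExpansions f₁)
    (h₂ : HasQuadraticExpansions f₂) : HasQuadraticExpansions (f₁ + f₂) := by
  obtain ⟨g₁, C₁, M₁, hC₁, h₁⟩ := h₁
  obtain ⟨g₂, C₂, M₂, hC₂, h₂⟩ := h₂
  refine ⟨g₁ + g₂, C₁ + C₂, M₁ + M₂, by positivity, fun u =>
    ⟨(norm_add_le _ _).trans (add_le_add (h₁ u).1 (h₂ u).1), fun x => ?_⟩⟩
  have e : (f₁ + f₂) x - (f₁ + f₂) u - inner ℝ ((g₁ + g₂) u)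
      ((x : EuclideanSpace ℝ (Fin n)) - u) =
      (f₁ x - f₁ u - inner ℝ (g₁ u) ((x : EuclideanSpace ℝ (Fin n)) - u)) +
      (f₂ x - f₂ u - inner ℝ (g₂ u) ((x : EuclideanSpace ℝ (Fin n)) - u)) := by
    simp only [ContinuousMap.add_apply, Pi.add_apply, inner_add_left]
    ring
  rw [e, add_mul]
  exact (abs_add_le _ _).trans (add_le_add ((h₁ u).2 x) ((h₂ u).2 x))

theorem norm_sub_le_two (x u : UnitSphere n) : ‖(x : EuclideanSpace ℝ (Fin n)) - u‖ ≤ 2 := by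
  refine (norm_sub_le _ _).trans ?_
  rw [mem_sphere_zero_iff_norm.mp x.2, mem_sphere_zero_iff_norm.mp u.2]
  norm_num

/-- A function with uniform quadratic expansions is Lipschitz. -/
theorem abs_sub_le_of_expansion {f : C(UnitSphere n, ℝ)} {C M : ℝ} {x u : UnitSphere n}
    {v : EuclideanSpace ℝ (Fin n)} (hC : 0 ≤ C) (hv : ‖v‖ ≤ M)
    (h : |f x - f u - inner ℝ v ((x : EuclideanSpace ℝ (Fin n)) - u)| ≤
      C * ‖(x : EuclideanSpace ℝ (Fin n)) - u‖ ^ 2) :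
    |f x - f u| ≤ (M + 2 * C) * ‖(x : EuclideanSpace ℝ (Fin n)) - u‖ := by
  set q := ‖(x : EuclideanSpace ℝ (Fin n)) - u‖
  have hq0 : 0 ≤ q := norm_nonneg _
  have h1 : |inner ℝ v ((x : EuclideanSpace ℝ (Fin n)) - u)| ≤ M * q :=
    (abs_real_inner_le_norm _ _).trans (mul_le_mul_of_nonneg_right hv hq0)
  have h2 : C * q ^ 2 ≤ 2 * C * q := by
    have := mul_le_mul_of_nonneg_left (norm_sub_le_two x u) (mul_nonneg hC hq0)
    calc C * q ^ 2 = C * q * q := by ring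
      _ ≤ C * q * 2 := this
      _ = _ := by ring
  calc |f x - f u| = |(f x - f u - inner ℝ v ((x : EuclideanSpace ℝ (Fin n)) - u)) +
        inner ℝ v ((x : EuclideanSpace ℝ (Fin n)) - u)| := by rw [sub_add_cancel]
    _ ≤ _ := abs_add_le _ _
    _ ≤ 2 * C * q + M * q := add_le_add (h.trans h2) h1
    _ = _ := by ring

theorem HasQuadraticExpansions.mul {f₁ f₂ : C(UnitSphere n, ℝ)} (h₁ : HasQuadraticExpansions f₁)
    (h₂ : HasQuadraticExpansions f₂) : HasQuadraticExpansions (f₁ * f₂) := by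
  obtain ⟨g₁, C₁, M₁, hC₁, h₁⟩ := h₁
  obtain ⟨g₂, C₂, M₂, hC₂, h₂⟩ := h₂
  refine ⟨fun u => f₁ u • g₂ u + f₂ u • g₁ u,
    ‖f₁‖ * C₂ + ‖f₂‖ * C₁ + |M₁ + 2 * C₁| * |M₂ + 2 * C₂|, ‖f₁‖ * M₂ + ‖f₂‖ * M₁, by positivity,
    fun u => ⟨?_, fun x => ?_⟩⟩
  · refine (norm_add_le _ _).trans (add_le_add ?_ ?_)
    · rw [norm_smul]
      exact mul_le_mul (f₁.norm_coe_le_norm u) (h₂ u).1 (norm_nonneg _) (norm_nonneg _)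
    · rw [norm_smul]
      exact mul_le_mul (f₂.norm_coe_le_norm u) (h₁ u).1 (norm_nonneg _) (norm_nonneg _)
  have l₁ := abs_sub_le_of_expansion hC₁ (h₁ u).1 ((h₁ u).2 x)
  have l₂ := abs_sub_le_of_expansion hC₂ (h₂ u).1 ((h₂ u).2 x)
  have t₁ := (h₁ u).2 x
  have t₂ := (h₂ u).2 x
  have b₁ : |f₁ u| ≤ ‖f₁‖ := f₁.norm_coe_le_norm u
  have b₂ : |f₂ u| ≤ ‖f₂‖ := f₂.norm_coe_le_norm u
  set q := ‖(x : EuclideanSpace ℝ (Fin n)) - u‖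
  have hq0 : 0 ≤ q := norm_nonneg _
  -- the product rule, with the product of the increments as second order error
  have e : (f₁ * f₂) x - (f₁ * f₂) u - inner ℝ (f₁ u • g₂ u + f₂ u • g₁ u)
      ((x : EuclideanSpace ℝ (Fin n)) - u) =
      f₁ u * (f₂ x - f₂ u - inner ℝ (g₂ u) ((x : EuclideanSpace ℝ (Fin n)) - u)) +
      f₂ u * (f₁ x - f₁ u - inner ℝ (g₁ u) ((x : EuclideanSpace ℝ (Fin n)) - u)) +
      (f₁ x - f₁ u) * (f₂ x - f₂ u) := by
    simp only [ContinuousMap.mul_apply, inner_add_left, inner_smul_left, conj_trivial]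
    ring
  have l₁' : |f₁ x - f₁ u| ≤ |M₁ + 2 * C₁| * q :=
    l₁.trans (mul_le_mul_of_nonneg_right (le_abs_self _) hq0)
  have l₂' : |f₂ x - f₂ u| ≤ |M₂ + 2 * C₂| * q :=
    l₂.trans (mul_le_mul_of_nonneg_right (le_abs_self _) hq0)
  rw [e]
  refine (abs_add_three _ _ _).trans ?_
  rw [abs_mul, abs_mul, abs_mul]
  calc _ ≤ ‖f₁‖ * (C₂ * q ^ 2) + ‖f₂‖ * (C₁ * q ^ 2) +
        (|M₁ + 2 * C₁| * q) * (|M₂ + 2 * C₂| * q) := by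
        gcongr
    _ = _ := by ring

/-- The algebra of functions on the sphere with uniform quadratic expansions. -/
def quadraticExpansionAlgebra (n : ℕ) : Subalgebra ℝ C(UnitSphere n, ℝ) where
  carrier := {f | HasQuadraticExpansions f}
  mul_mem' h₁ h₂ := h₁.mul h₂
  add_mem' h₁ h₂ := h₁.add h₂
  algebraMap_mem' c := hasQuadraticExpansions_const c

theorem exists_mem_quadraticExpansionAlgebra_norm_sub_le (f : C(UnitSphere n, ℝ)) {ε : ℝ}
    (hε : 0 < ε) : ∃ g ∈ quadraticExpansionAlgebra n, ‖g - f‖ ≤ ε := by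
  have hsep : (quadraticExpansionAlgebra n).SeparatesPoints := by
    intro x y hxy
    refine ⟨_, ⟨_, hasQuadraticExpansions_inner (x : EuclideanSpace ℝ (Fin n)), rfl⟩, ?_⟩
    simp only [ContinuousMap.coe_mk]
    intro h
    apply hxy
    have hx := mem_sphere_zero_iff_norm.mp x.2
    have hy := mem_sphere_zero_iff_norm.mp y.2
    rw [real_inner_self_eq_norm_sq, hx, one_pow] at h
    exact Subtype.ext ((inner_eq_one_iff_of_norm_eq_one hx hy).mp h.symm)
  obtain ⟨g, hg⟩ := ContinuousMap.exists_mem_subalgebra_near_continuousMap_of_separatesPoints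
    (quadraticExpansionAlgebra n) hsep f ε hε
  exact ⟨g, g.2, hg.le⟩

/-- If `f` has uniform quadratic expansions, then `c + f` is a support function for all large
`c`. -/
theorem HasQuadraticExpansions.exists_supportFunction_eq {f : C(UnitSphere n, ℝ)}
    (hf : HasQuadraticExpansions f) :
    ∃ c₀ : ℝ, ∀ c, c₀ ≤ c → ∃ L : ConvexBody (EuclideanSpace ℝ (Fin n)),
      ∀ u : UnitSphere n, L.supportFunction u = c + f u := by
  obtain ⟨g, C, M, hC, h⟩ := hf
  refine ⟨max ‖f‖ (2 * C + ‖f‖ + M), fun c hc => ?_⟩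
  have hc1 : ‖f‖ ≤ c := (le_max_left _ _).trans hc
  have hc2 : 2 * C + ‖f‖ + M ≤ c := (le_max_right _ _).trans hc
  have hfb : ∀ u, |f u| ≤ ‖f‖ := fun u => f.norm_coe_le_norm u
  set s : Set (EuclideanSpace ℝ (Fin n)) :=
    {y | ∀ u : UnitSphere n, inner ℝ y (u : EuclideanSpace ℝ (Fin n)) ≤ c + f u} with hs
  have hconv : Convex ℝ s := by
    intro y hy z hz a b ha hb hab u
    rw [inner_add_left, inner_smul_left, inner_smul_left, conj_trivial, conj_trivial]
    calc a * inner ℝ y (u : EuclideanSpace ℝ (Fin n)) + b * inner ℝ z (u : EuclideanSpace ℝ (Fin n))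
        ≤ a * (c + f u) + b * (c + f u) :=
          add_le_add (mul_le_mul_of_nonneg_left (hy u) ha) (mul_le_mul_of_nonneg_left (hz u) hb)
      _ = c + f u := by rw [← add_mul, hab, one_mul]
  have hclosed : IsClosed s := by
    rw [hs, Set.ofPred_forall]
    exact isClosed_iInter fun u => isClosed_le (by fun_prop) continuous_const
  have hbdd : s ⊆ Metric.closedBall 0 (c + ‖f‖) := by
    intro y hy
    rw [mem_closedBall_zero_iff]
    rcases eq_or_ne y 0 with rfl | hy0
    · rw [norm_zero]
      have := norm_nonneg f
      linarith
    have h0 : ‖y‖ ≠ 0 := norm_ne_zero_iff.mpr hy0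
    have hsph : ‖y‖⁻¹ • y ∈ Metric.sphere (0 : EuclideanSpace ℝ (Fin n)) 1 := by
      rw [mem_sphere_zero_iff_norm, norm_smul, norm_inv, norm_norm, inv_mul_cancel₀ h0]
    have h1 := hy ⟨_, hsph⟩
    rw [inner_smul_right, real_inner_self_eq_norm_sq, sq, ← mul_assoc, inv_mul_cancel₀ h0,
      one_mul] at h1
    exact h1.trans (add_le_add le_rfl ((le_abs_self _).trans (hfb _)))
  have hne : s.Nonempty := by
    refine ⟨0, fun u => ?_⟩
    rw [inner_zero_left]
    have := (abs_le.mp (hfb u)).1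
    linarith
  refine ⟨⟨s, hconv, (isCompact_closedBall _ _).of_isClosed_subset hclosed hbdd, hne⟩, fun x => ?_⟩
  apply le_antisymm
  · exact supportFunction_le fun y hy => hy x
  -- the point of the boundary with outer normal `x`
  set y : EuclideanSpace ℝ (Fin n) := (c + f x - inner ℝ (g x) (x : EuclideanSpace ℝ (Fin n))) •
    (x : EuclideanSpace ℝ (Fin n)) + g x with hy
  have hxx : inner ℝ (x : EuclideanSpace ℝ (Fin n)) (x : EuclideanSpace ℝ (Fin n)) = (1 : ℝ) := by
    rw [real_inner_self_eq_norm_sq, mem_sphere_zero_iff_norm.mp x.2, one_pow]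
  have hyx : inner ℝ y (x : EuclideanSpace ℝ (Fin n)) = c + f x := by
    rw [hy, inner_add_left, inner_smul_left, conj_trivial, hxx]
    ring
  rw [← hyx]
  refine inner_le_supportFunction (show y ∈ s from fun u => ?_) _
  set q := ‖(u : EuclideanSpace ℝ (Fin n)) - x‖ ^ 2 with hq
  have hq0 : 0 ≤ q := by positivity
  have hxu : inner ℝ (x : EuclideanSpace ℝ (Fin n)) (u : EuclideanSpace ℝ (Fin n)) = 1 - q / 2 := by
    rw [hq, norm_sub_sq_real, mem_sphere_zero_iff_norm.mp x.2, mem_sphere_zero_iff_norm.mp u.2,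
      real_inner_comm]
    ring
  have h1 := (abs_le.mp ((h x).2 u)).1
  rw [← hq, inner_sub_right] at h1
  have h2 : |inner ℝ (g x) (x : EuclideanSpace ℝ (Fin n))| ≤ M := by
    refine (abs_real_inner_le_norm _ _).trans ?_
    rw [mem_sphere_zero_iff_norm.mp x.2, mul_one]
    exact (h x).1
  have h3 := (abs_le.mp h2).2
  have h4 := (abs_le.mp (hfb x)).1
  rw [hy, inner_add_left, inner_smul_left, conj_trivial, hxu]
  have h5 : 2 * C ≤ c + f x - inner ℝ (g x) (x : EuclideanSpace ℝ (Fin n)) := by linarith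
  have h6 := mul_le_mul_of_nonneg_right h5 hq0
  linarith

end QuadraticExpansion

/-! ### The mixed area functional -/

variable {m : ℕ}

/-- For `f` in the dense algebra, `c + f` is a support function whose integral against every
surface area measure is the first variation of volume. -/
theorem exists_supportFunction_eq_and_integral_eq {f : C(UnitSphere (m + 1), ℝ)}
    (hf : f ∈ quadraticExpansionAlgebra (m + 1)) :
    ∃ (c : ℝ) (L : ConvexBody (EuclideanSpace ℝ (Fin (m + 1)))), 0 ≤ c ∧
      (∀ u : UnitSphere (m + 1), L.supportFunction u = c + f u) ∧
      ∀ K : ConvexBody (EuclideanSpace ℝ (Fin (m + 1))),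
        ∫ u : UnitSphere (m + 1), (c + f u) ∂(K.surfaceAreaMeasure : Measure _) =
          (m + 1 : ℕ) * mixedVolumeLast (fun _ : Fin m => K) L := by
  obtain ⟨c₁, h₁⟩ := HasQuadraticExpansions.exists_supportFunction_eq hf
  obtain ⟨c₂, h₂⟩ := HasQuadraticExpansions.exists_supportFunction_eq
    ((quadraticExpansionAlgebra (m + 1)).neg_mem hf)
  set c := max ‖f‖ (max c₁ c₂)
  obtain ⟨L, hL⟩ := h₁ c ((le_max_left _ _).trans (le_max_right _ _))
  obtain ⟨L', hL'⟩ := h₂ c ((le_max_right _ _).trans (le_max_right _ _))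
  have hfc : ‖f‖ ≤ c := le_max_left _ _
  have hc : 0 ≤ c := (norm_nonneg f).trans hfc
  have hfb : ∀ u, |f u| ≤ c := fun u => (f.norm_coe_le_norm u).trans hfc
  refine ⟨c, L, hc, hL, fun K => ?_⟩
  rw [mul_mixedVolumeLast_eq_integral_of_add K L L' (fun u => ?_) (fun u => ?_)
    (c := 2 * c) (by positivity) (fun u => ?_)]
  · simp_rw [hL]
  · rw [hL]
    have := (abs_le.mp (hfb u)).1
    linarith
  · rw [hL', ContinuousMap.neg_apply]
    have := (abs_le.mp (hfb u)).2
    linarith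
  · rw [hL, hL', ContinuousMap.neg_apply]
    ring

/-- The integral of a function against the polarized surface area measures. -/
noncomputable def mixedAreaFunctional
    (P : Fin m → ConvexBody (EuclideanSpace ℝ (Fin (m + 1)))) (f : C(UnitSphere (m + 1), ℝ)) : ℝ :=
  (m.factorial : ℝ)⁻¹ * ∑ I : Finset (Fin m), (-1 : ℝ) ^ (m - I.card) *
    ∫ u, f u ∂(surfaceAreaMeasure (∑ i ∈ I, P i) : Measure (UnitSphere (m + 1)))

theorem integrable_continuousMap {n : ℕ} (f : C(UnitSphere n, ℝ)) (S : Measure (UnitSphere n))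
    [IsFiniteMeasure S] : Integrable f S :=
  f.continuous.integrable_of_hasCompactSupport (HasCompactSupport.of_compactSpace _)

variable (P : Fin m → ConvexBody (EuclideanSpace ℝ (Fin (m + 1))))

theorem mixedAreaFunctional_add (f g : C(UnitSphere (m + 1), ℝ)) :
    mixedAreaFunctional P (f + g) = mixedAreaFunctional P f + mixedAreaFunctional P g := by
  simp only [mixedAreaFunctional]
  rw [← mul_add, ← Finset.sum_add_distrib]
  congr 1
  refine Finset.sum_congr rfl fun I _ => ?_
  rw [← mul_add, ← integral_add (integrable_continuousMap f _) (integrable_continuousMap g _)]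
  rfl

theorem mixedAreaFunctional_smul (c : ℝ) (f : C(UnitSphere (m + 1), ℝ)) :
    mixedAreaFunctional P (c • f) = c * mixedAreaFunctional P f := by
  simp only [mixedAreaFunctional, ContinuousMap.smul_apply, smul_eq_mul, integral_const_mul]
  rw [mul_left_comm c, Finset.mul_sum _ _ c]
  congr 1
  refine Finset.sum_congr rfl fun I _ => ?_
  ring

theorem exists_abs_mixedAreaFunctional_le :
    ∃ A, 0 ≤ A ∧ ∀ f, |mixedAreaFunctional P f| ≤ A * ‖f‖ := by
  set σ : Finset (Fin m) → ℝ := fun I =>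
    ((∑ i ∈ I, P i).surfaceAreaMeasure : Measure (UnitSphere (m + 1))).real Set.univ
  refine ⟨(m.factorial : ℝ)⁻¹ * ∑ I : Finset (Fin m), σ I,
    mul_nonneg (by positivity)
      (Finset.sum_nonneg fun I _ => (measureReal_nonneg : 0 ≤ σ I)), fun f => ?_⟩
  rw [mixedAreaFunctional, abs_mul, abs_of_nonneg (by positivity : (0 : ℝ) ≤ (m.factorial : ℝ)⁻¹),
    mul_assoc, Finset.sum_mul]
  refine mul_le_mul_of_nonneg_left ?_ (by positivity)
  refine (Finset.abs_sum_le_sum_abs _ _).trans (Finset.sum_le_sum fun I _ => ?_)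
  rw [abs_mul, abs_pow, abs_neg, abs_one, one_pow, one_mul, mul_comm]
  exact norm_integral_le_of_norm_le_const (Eventually.of_forall fun u => f.norm_coe_le_norm u)

theorem mixedAreaFunctional_eq_of_forall {f : C(UnitSphere (m + 1), ℝ)}
    {L : ConvexBody (EuclideanSpace ℝ (Fin (m + 1)))}
    (h : ∀ K : ConvexBody (EuclideanSpace ℝ (Fin (m + 1))),
      ∫ u, f u ∂(K.surfaceAreaMeasure : Measure (UnitSphere (m + 1))) =
        (m + 1 : ℕ) * mixedVolumeLast (fun _ : Fin m => K) L) :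
    mixedAreaFunctional P f = (m + 1 : ℕ) * mixedVolumeLast P L := by
  have h0 : (m.factorial : ℝ) ≠ 0 := by positivity
  simp only [mixedAreaFunctional, h]
  rw [inv_mul_eq_iff_eq_mul₀ h0, mul_left_comm, ← sum_neg_one_pow_card_mixedVolumeLast,
    Finset.mul_sum]
  refine Finset.sum_congr rfl fun I _ => ?_
  ring

theorem mixedAreaFunctional_one :
    mixedAreaFunctional P 1 = (m + 1 : ℕ) * mixedVolumeLast P (unitBall (m + 1)) := by
  refine mixedAreaFunctional_eq_of_forall P fun K => ?_
  have h1 := mul_mixedVolumeLast_le_integral K (unitBall (m + 1))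
    (fun u => by rw [supportFunction_unitBall]; exact norm_nonneg _)
  have h2 := K.surfaceAreaMeasure_univ_le
  have e : ∀ u : UnitSphere (m + 1), (unitBall (m + 1)).supportFunction u = 1 := fun u => by
    rw [supportFunction_unitBall, mem_sphere_zero_iff_norm.mp u.2]
  simp_rw [e] at h1
  rw [integral_const, smul_eq_mul, mul_one] at h1
  simp only [ContinuousMap.one_apply, integral_const, smul_eq_mul, mul_one]
  exact le_antisymm h2 h1

/-- On the dense algebra, the mixed area functional is a difference of mixed volumes. -/
theorem exists_mixedAreaFunctional_eq {f : C(UnitSphere (m + 1), ℝ)}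
    (hf : f ∈ quadraticExpansionAlgebra (m + 1)) :
    ∃ (c : ℝ) (L : ConvexBody (EuclideanSpace ℝ (Fin (m + 1)))), 0 ≤ c ∧
      (∀ u : UnitSphere (m + 1), L.supportFunction u = c + f u) ∧
      mixedAreaFunctional P f = (m + 1 : ℕ) *
        (mixedVolumeLast P L - c * mixedVolumeLast P (unitBall (m + 1))) := by
  obtain ⟨c, L, hc, hL, h⟩ := exists_supportFunction_eq_and_integral_eq hf
  refine ⟨c, L, hc, hL, ?_⟩
  have h1 : mixedAreaFunctional P (c • 1 + f) = (m + 1 : ℕ) * mixedVolumeLast P L := by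
    refine mixedAreaFunctional_eq_of_forall P fun K => ?_
    rw [← h K]
    simp
  rw [mixedAreaFunctional_add, mixedAreaFunctional_smul, mixedAreaFunctional_one] at h1
  linarith

theorem mixedAreaFunctional_nonneg {f : C(UnitSphere (m + 1), ℝ)} (hf : ∀ u, 0 ≤ f u) :
    0 ≤ mixedAreaFunctional P f := by
  obtain ⟨A, hA0, hA⟩ := exists_abs_mixedAreaFunctional_le P
  set β := mixedAreaFunctional P 1 with hβ
  have key : ∀ ε : ℝ, 0 < ε → 0 ≤ mixedAreaFunctional P f + ε * (A + β) := by
    intro ε hε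
    obtain ⟨g, hg, hgf⟩ := exists_mem_quadraticExpansionAlgebra_norm_sub_le f hε
    have hgε : ε • (1 : C(UnitSphere (m + 1), ℝ)) + g ∈ quadraticExpansionAlgebra (m + 1) :=
      add_mem (Subalgebra.smul_mem _ (one_mem _) _) hg
    obtain ⟨c, L, hc, hL, h⟩ := exists_mixedAreaFunctional_eq P hgε
    have h1 : mixedVolumeLast P (c • unitBall (m + 1)) ≤ mixedVolumeLast P L := by
      refine mixedVolumeLast_mono P (supportFunction_le_of_forall_unitSphere fun u => ?_)
      rw [supportFunction_smul_body _ hc, supportFunction_unitBall, hL,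
        mem_sphere_zero_iff_norm.mp u.2, mul_one]
      have h2 : |g u - f u| ≤ ε := ((g - f).norm_coe_le_norm u).trans hgf
      have h3 := (abs_le.mp h2).1
      have h4 := hf u
      simp only [ContinuousMap.add_apply, ContinuousMap.smul_apply, ContinuousMap.one_apply,
        smul_eq_mul, mul_one]
      linarith
    rw [mixedVolumeLast_smul _ _ hc] at h1
    have h5 : 0 ≤ mixedAreaFunctional P (ε • (1 : C(UnitSphere (m + 1), ℝ)) + g) := by
      rw [h]
      exact mul_nonneg (Nat.cast_nonneg _) (sub_nonneg.mpr h1)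
    have h6 : mixedAreaFunctional P g =
        mixedAreaFunctional P f + mixedAreaFunctional P (g - f) := by
      rw [← mixedAreaFunctional_add, add_sub_cancel]
    have h7 := (le_abs_self _).trans ((hA (g - f)).trans (mul_le_mul_of_nonneg_left hgf hA0))
    rw [mixedAreaFunctional_add, mixedAreaFunctional_smul, h6, ← hβ] at h5
    linarith
  have hlim : Tendsto (fun ε : ℝ => mixedAreaFunctional P f + ε * (A + β)) (𝓝[>] 0)
      (𝓝 (mixedAreaFunctional P f + 0 * (A + β))) :=
    ((tendsto_id.mul_const _).const_add _).mono_left nhdsWithin_le_nhds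
  rw [zero_mul, add_zero] at hlim
  refine ge_of_tendsto hlim ?_
  filter_upwards [self_mem_nhdsWithin] with ε hε
  exact key ε hε

/-- The restriction of the support function to the unit sphere. -/
noncomputable def supportFunctionOnSphere {n : ℕ} (Q : ConvexBody (EuclideanSpace ℝ (Fin n))) :
    C(UnitSphere n, ℝ) :=
  ⟨fun u => Q.supportFunction u, Q.continuous_supportFunction.comp continuous_subtype_val⟩

theorem mixedAreaFunctional_supportFunction
    (Q : ConvexBody (EuclideanSpace ℝ (Fin (m + 1)))) :
    mixedAreaFunctional P Q.supportFunctionOnSphere = (m + 1 : ℕ) * mixedVolumeLast P Q := by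
  obtain ⟨A, hA0, hA⟩ := exists_abs_mixedAreaFunctional_le P
  set f := Q.supportFunctionOnSphere with hf
  set W := mixedVolumeLast P (unitBall (m + 1)) with hW
  have key : ∀ ε : ℝ, 0 < ε →
      |mixedAreaFunctional P f - (m + 1 : ℕ) * mixedVolumeLast P Q| ≤
        ε * (A + (m + 1 : ℕ) * W) := by
    intro ε hε
    obtain ⟨g, hg, hgf⟩ := exists_mem_quadraticExpansionAlgebra_norm_sub_le f hε
    obtain ⟨c, L, hc, hL, h⟩ := exists_mixedAreaFunctional_eq P hg
    have hclose : ∀ u : UnitSphere (m + 1), |g u - Q.supportFunction u| ≤ ε := fun u =>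
      ((g - f).norm_coe_le_norm u).trans hgf
    have h1 : mixedVolumeLast P L ≤ mixedVolumeLast P Q + (c + ε) * W := by
      rw [hW, ← mixedVolumeLast_smul _ _ (by positivity), ← mixedVolumeLast_add]
      refine mixedVolumeLast_mono P (supportFunction_le_of_forall_unitSphere fun u => ?_)
      rw [hL, supportFunction_add_body, supportFunction_smul_body _ (by positivity),
        supportFunction_unitBall, mem_sphere_zero_iff_norm.mp u.2, mul_one]
      have := (abs_le.mp (hclose u)).2
      linarith
    have h2 : mixedVolumeLast P Q + c * W ≤ mixedVolumeLast P L + ε * W := by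
      rw [hW, ← mixedVolumeLast_smul _ _ hc, ← mixedVolumeLast_smul _ _ hε.le,
        ← mixedVolumeLast_add, ← mixedVolumeLast_add]
      refine mixedVolumeLast_mono P (supportFunction_le_of_forall_unitSphere fun u => ?_)
      rw [supportFunction_add_body, supportFunction_add_body, hL,
        supportFunction_smul_body _ hc, supportFunction_smul_body _ hε.le,
        supportFunction_unitBall, mem_sphere_zero_iff_norm.mp u.2, mul_one, mul_one]
      have := (abs_le.mp (hclose u)).1
      linarith
    have h3 : |mixedAreaFunctional P g - (m + 1 : ℕ) * mixedVolumeLast P Q| ≤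
        ε * ((m + 1 : ℕ) * W) := by
      rw [h, ← mul_sub, abs_mul, Nat.abs_cast, mul_left_comm]
      refine mul_le_mul_of_nonneg_left ?_ (Nat.cast_nonneg _)
      rw [abs_le]
      constructor <;> linarith
    have h6 : mixedAreaFunctional P g =
        mixedAreaFunctional P f + mixedAreaFunctional P (g - f) := by
      rw [← mixedAreaFunctional_add, add_sub_cancel]
    have h7 := (hA (g - f)).trans (mul_le_mul_of_nonneg_left hgf hA0)
    have h8 : mixedAreaFunctional P f - (m + 1 : ℕ) * mixedVolumeLast P Q =
        (mixedAreaFunctional P g - (m + 1 : ℕ) * mixedVolumeLast P Q) -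
          mixedAreaFunctional P (g - f) := by rw [h6]; ring
    rw [h8]
    refine (abs_sub _ _).trans ?_
    linarith
  have hlim : Tendsto (fun ε : ℝ => ε * (A + (m + 1 : ℕ) * W)) (𝓝[>] 0)
      (𝓝 (0 * (A + (m + 1 : ℕ) * W))) :=
    (tendsto_id.mul_const _).mono_left nhdsWithin_le_nhds
  rw [zero_mul] at hlim
  have h0 : |mixedAreaFunctional P f - (m + 1 : ℕ) * mixedVolumeLast P Q| ≤ 0 := by
    refine ge_of_tendsto hlim ?_
    filter_upwards [self_mem_nhdsWithin] with ε hε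
    exact key ε hε
  exact sub_eq_zero.mp (abs_nonpos_iff.mp h0)

end ConvexBody

/-! ### The mixed area measure -/

/-- By approximating indicators of closed sets with thickened indicators, and inner regularity with
respect to closed sets. -/
theorem MeasureTheory.Measure.le_of_forall_integral_le {X : Type*} [PseudoMetricSpace X]
    [MeasurableSpace X] [BorelSpace X] {μ ν : Measure X} [IsFiniteMeasure μ] [IsFiniteMeasure ν]
    (h : ∀ f : C(X, ℝ), (∀ x, 0 ≤ f x) → ∫ x, f x ∂μ ≤ ∫ x, f x ∂ν) : μ ≤ ν := by
  have hclosed : ∀ F : Set X, IsClosed F → μ F ≤ ν F := by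
    intro F hF
    have h1 := tendsto_lintegral_thickenedIndicator_of_isClosed μ hF
      (δs := fun k => 1 / ((k : ℝ) + 1)) (fun k => by positivity)
      tendsto_one_div_add_atTop_nhds_zero_nat
    have h2 := tendsto_lintegral_thickenedIndicator_of_isClosed ν hF
      (δs := fun k => 1 / ((k : ℝ) + 1)) (fun k => by positivity)
      tendsto_one_div_add_atTop_nhds_zero_nat
    refine le_of_tendsto_of_tendsto' h1 h2 fun k => ?_
    set φ := thickenedIndicator (by positivity : 0 < 1 / ((k : ℝ) + 1)) F
    have h3 := h ⟨fun x => (φ x : ℝ), by fun_prop⟩ (fun x => (φ x).2)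
    have e : ∀ (κ : Measure X) [IsFiniteMeasure κ],
        ∫⁻ x, (φ x : ENNReal) ∂κ = ENNReal.ofReal (∫ x, (φ x : ℝ) ∂κ) := by
      intro κ _
      rw [← φ.toReal_lintegral_coe_eq_integral κ,
        ENNReal.ofReal_toReal (φ.lintegral_lt_top_of_nnreal κ).ne]
    rw [e μ, e ν]
    exact ENNReal.ofReal_le_ofReal h3
  refine Measure.le_iff.mpr fun s hs => ?_
  rw [hs.measure_eq_iSup_isClosed_of_ne_top (measure_ne_top μ s)]
  refine iSup_le fun F => iSup_le fun hFs => iSup_le fun hF => ?_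
  exact (hclosed F hF).trans (measure_mono hFs)

theorem MeasureTheory.Measure.toJordanDecomposition_posPart_toSignedMeasure {Ω : Type*}
    [MeasurableSpace Ω] (μ : Measure Ω) [IsFiniteMeasure μ] :
    μ.toSignedMeasure.toJordanDecomposition.posPart = μ := by
  let j : JordanDecomposition Ω := ⟨μ, 0, Measure.MutuallySingular.zero_right⟩
  have hj : μ.toSignedMeasure = j.toSignedMeasure := by
    simp [j, JordanDecomposition.toSignedMeasure]
  rw [SignedMeasure.toJordanDecomposition_eq hj]

namespace ConvexBody

variable {m : ℕ} (P : Fin m → ConvexBody (EuclideanSpace ℝ (Fin (m + 1))))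

/-- Integration against the mixed area measure is the mixed area functional. The polarization is a
difference of two finite measures, and the first dominates the second since the functional is
nonnegative. -/
theorem integral_mixedAreaMeasure (f : C(UnitSphere (m + 1), ℝ)) :
    ∫ u, f u ∂(mixedAreaMeasure P) = mixedAreaFunctional P f := by
  set σ : Finset (Fin m) → Measure (UnitSphere (m + 1)) := fun I =>
    ((∑ i ∈ I, P i).surfaceAreaMeasure : Measure (UnitSphere (m + 1))) with hσ
  have hσfin : ∀ I, IsFiniteMeasure (σ I) := fun I => by rw [hσ]; infer_instance
  set e : Finset (Finset (Fin m)) := Finset.univ.filter fun I => Even (m - I.card) with he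
  set o : Finset (Finset (Fin m)) := Finset.univ.filter fun I => ¬ Even (m - I.card) with ho
  set μp : Measure (UnitSphere (m + 1)) := ∑ I ∈ e, σ I with hμp
  set μn : Measure (UnitSphere (m + 1)) := ∑ I ∈ o, σ I with hμn
  have hpfin : IsFiniteMeasure μp := by rw [hμp]; infer_instance
  have hnfin : IsFiniteMeasure μn := by rw [hμn]; infer_instance
  have split : ∀ a : Finset (Fin m) → ℝ, ∑ I : Finset (Fin m), (-1 : ℝ) ^ (m - I.card) * a I =
      ∑ I ∈ e, a I - ∑ I ∈ o, a I := by
    intro a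
    rw [← Finset.sum_filter_add_sum_filter_not Finset.univ fun I : Finset (Fin m) =>
      Even (m - I.card), sub_eq_add_neg, ← Finset.sum_neg_distrib]
    congr 1
    · refine Finset.sum_congr rfl fun I hI => ?_
      rw [(Finset.mem_filter.mp hI).2.neg_one_pow, one_mul]
    · refine Finset.sum_congr rfl fun I hI => ?_
      rw [(Nat.not_even_iff_odd.mp (Finset.mem_filter.mp hI).2).neg_one_pow, neg_one_mul]
  have hint : ∀ g : C(UnitSphere (m + 1), ℝ), mixedAreaFunctional P g =
      (m.factorial : ℝ)⁻¹ * (∫ u, g u ∂μp - ∫ u, g u ∂μn) := by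
    intro g
    rw [mixedAreaFunctional, split, hμp, hμn,
      integral_finsetSum_measure fun I _ => integrable_continuousMap g _,
      integral_finsetSum_measure fun I _ => integrable_continuousMap g _]
  have h0 : (0 : ℝ) < (m.factorial : ℝ)⁻¹ := by positivity
  have hle : μn ≤ μp := by
    refine Measure.le_of_forall_integral_le fun g hg => ?_
    have h1 := mixedAreaFunctional_nonneg P hg
    rw [hint] at h1
    exact sub_nonneg.mp (nonneg_of_mul_nonneg_right h1 h0)
  set lam : Measure (UnitSphere (m + 1)) := ((m.factorial : NNReal)⁻¹) • (μp - μn) with hlam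
  have hlamfin : IsFiniteMeasure lam := by rw [hlam]; infer_instance
  have hsub : μp = (μp - μn) + μn := (Measure.sub_add_cancel_of_le hle).symm
  have hsigned : mixedAreaSignedMeasure P = lam.toSignedMeasure := by
    ext s hs
    rw [Measure.toSignedMeasure_apply_measurable hs, hlam, measureReal_nnreal_smul_apply,
      mixedAreaSignedMeasure, _root_.smul_apply, _root_.sum_apply]
    have e1 : ∀ I : Finset (Fin m), ((-1 : ℝ) ^ (m - I.card) •
        ((∑ i ∈ I, P i).surfaceAreaMeasure :
          Measure (UnitSphere (m + 1))).toSignedMeasure) s =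
        (-1 : ℝ) ^ (m - I.card) * (σ I).real s := by
      intro I
      rw [_root_.smul_apply, Measure.toSignedMeasure_apply_measurable hs, smul_eq_mul]
    rw [Finset.sum_congr rfl fun I _ => e1 I, split]
    have e2 : (μp - μn).real s = μp.real s - μn.real s := by
      conv_rhs => rw [hsub]
      rw [measureReal_add_apply, add_sub_cancel_right]
    have e3 : ∀ J : Finset (Finset (Fin m)), (∑ I ∈ J, σ I).real s = ∑ I ∈ J, (σ I).real s := by
      intro J
      simp only [Measure.real, Measure.coe_finsetSum, Finset.sum_apply]
      exact ENNReal.toReal_sum fun I _ => measure_ne_top _ _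
    rw [e2, hμp, hμn, e3, e3]
    simp
  rw [mixedAreaMeasure, hsigned, Measure.toJordanDecomposition_posPart_toSignedMeasure, hlam,
    integral_smul_nnreal_measure, hint]
  have e4 : ∫ u, f u ∂μp = ∫ u, f u ∂(μp - μn) + ∫ u, f u ∂μn := by
    conv_lhs => rw [hsub]
    exact integral_add_measure (integrable_continuousMap f _) (integrable_continuousMap f _)
  rw [e4, add_sub_cancel_right, NNReal.smul_def]
  simp

end ConvexBody

/-- The dimension is `n = m + 1 ≥ 1`, and `P 0, …, P (m - 1)` are the `n - 1` bodies. -/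
theorem mainTheorem9 (m : ℕ) (P : Fin m → ConvexBody (EuclideanSpace ℝ (Fin (m + 1))))
    (Q Q' : ConvexBody (EuclideanSpace ℝ (Fin (m + 1))))
    (hQ : (Q : Set (EuclideanSpace ℝ (Fin (m + 1)))) ⊆ Q') :
    ConvexBody.mixedVolume
        (Fin.snoc (α := fun _ => ConvexBody (EuclideanSpace ℝ (Fin (m + 1)))) P Q') -
      ConvexBody.mixedVolume
        (Fin.snoc (α := fun _ => ConvexBody (EuclideanSpace ℝ (Fin (m + 1)))) P Q) =
    1 / ((m + 1 : ℕ) : ℝ) * ∫ u : ConvexBody.UnitSphere (m + 1),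
      (Q'.supportFunction (u : EuclideanSpace ℝ (Fin (m + 1))) -
        Q.supportFunction (u : EuclideanSpace ℝ (Fin (m + 1))))
        ∂(ConvexBody.mixedAreaMeasure P) := by
  have h1 := ConvexBody.mixedAreaFunctional_supportFunction P Q'
  have h2 := ConvexBody.mixedAreaFunctional_supportFunction P Q
  rw [← ConvexBody.integral_mixedAreaMeasure] at h1 h2
  have hfin : IsFiniteMeasure (ConvexBody.mixedAreaMeasure P) := by
    rw [ConvexBody.mixedAreaMeasure]; infer_instance
  rw [integral_sub (Q'.integrable_supportFunction _) (Q.integrable_supportFunction _)]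
  change ConvexBody.mixedVolumeLast P Q' - ConvexBody.mixedVolumeLast P Q = _
  have h3 : ∫ u : ConvexBody.UnitSphere (m + 1), Q'.supportFunction u
      ∂(ConvexBody.mixedAreaMeasure P) = (m + 1 : ℕ) * ConvexBody.mixedVolumeLast P Q' := h1
  have h4 : ∫ u : ConvexBody.UnitSphere (m + 1), Q.supportFunction u
      ∂(ConvexBody.mixedAreaMeasure P) = (m + 1 : ℕ) * ConvexBody.mixedVolumeLast P Q := h2
  rw [h3, h4]
  have h0 : ((m + 1 : ℕ) : ℝ) ≠ 0 := by positivity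
  field_simp
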